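/- Let $N\ge 1$, $s\in(0,1)$, and let $\Omega\subset\mathbb{R}^N$ be a nonempty bounded open set (for instance a bounded Lipschitz domain). For $\delta\in(0,\infty]$ put $\partial_\delta\Omega=\{y\in\mathbb{R}^N\setminus\Omega:\ |x-y|<\delta\text{ for some }x\in\Omega\}$ and $\Omega_\delta=\Omega\cup\partial_\delta\Omega$ (so $\partial_\infty\Omega=\mathbb{R}^N\setminus\Omega$ and $\Omega_\infty=\mathbb{R}^N$), let $$\langle u,v\rangle_{\delta}=\int_{\Omega_\delta}\int_{\Omega_\delta\cap B(x,\delta)}\frac{(u(x)-u(y))(v(x)-v(y))}{|x-y|^{N+2s}}\,dy\,dx$$ (with $B(x,\infty)=\mathbb{R}^N$), and let $\mathbb{H}^{\delta,s}_0(\Omega)$ be the space of all $u\in L^2(\Omega_\delta)$ with $u=0$ a.e. on $\partial_\delta\Omega$ and $\langle u,u\rangle_\delta<\infty$. Let $c_{N,s}=\frac{2^{2s}s\,\Gamma(\frac N2+s)}{\pi^{N/2}\Gamma(1-s)}$. A function $u\in\mathbb{H}^{\delta,s}_0(\Omega)$, $u\neq0$, is an eigenfunction with eigenvalue $\mu\in\mathbb{R}$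 of the horizon-$\delta$ fractional Laplacian $(-\Delta)^s_\delta$ with Dirichlet condition on $\partial_\delta\Omega$ if $$\frac{c_{N,s}}2\langle u,v\rangle_\delta=\mu\int_\Omega uv\,dx\qquad\text{for all }v\in\mathbb{H}^{\delta,s}_0(\Omega);$$ for $\delta=\infty$ this is the eigenvalue problem of the standard fractional Laplacian with exterior Dirichlet condition on $\mathbb{R}^N\setminus\Omega$. Let $\lambda^{\delta,s}_1\le\lambda^{\delta,s}_2\le\dots$ be the eigenvalues, repeated according to multiplicity, and let $m^{\delta,s}_k$ be the multiplicity of $\lambda^{\delta,s}_k$, i.e. the dimension of its eigenspace. An eigenbasis for $\delta$ is an orthonormal basis $(\varphi_k)_{k\ge1}$ of $L^2(\Omega)$ such that $\varphi_k$ is (the restriction to $\Omega$ of) an eigenfunction with eigenvalue $\lambda^{\delta,s}_k$. For every $\delta\in(0,\infty]$ these objects are well defined: an eigenbasis exists, $\lambda^{\delta,s}_1>0$, $\lambda^{\delta,s}_k\to\infty$ as $k\to\infty$, and $1\le m^{\delta,s}_k<\infty$ for all $k$. Moreover: 1. For every $k\ge1$, $\lambda^{\delta,s}_k\to\lambda^{\infty,s}_k$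 as $\delta\to+\infty$. 2. Let $(\varphi^{\delta,s}_k)_{k\ge1}$ be any eigenbasis for $\delta$, for each $\delta\in(0,\infty)$. Then every sequence $\delta_n\to+\infty$ has a subsequence $(\delta_{n_j})_j$ for which there is an eigenbasis $(\varphi^{\infty,s}_k)_{k\ge1}$ for $\delta=\infty$ with $\varphi^{\delta_{n_j},s}_k\to\varphi^{\infty,s}_k$ in $L^2(\Omega)$ as $j\to\infty$, for every $k\ge1$. 3. For every $k\ge1$, $m^{\delta,s}_k\to m^{\infty,s}_k$ as $\delta\to+\infty$. -/

import Mathlib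

open Set Filter Topology MeasureTheory

/-! The horizon `δ` is an extended nonnegative number. For `δ = ⊤` (and nonempty `Ω`) the sets and
the form below become those of the standard fractional Laplacian: the nonlocal domain is the whole
space, the nonlocal boundary is the complement of `Ω`, and all pairs of points interact. -/

namespace FiniteHorizon

noncomputable section

/-- The nonlocal boundary `∂_δ Ω`: the points outside `Ω` at distance `< δ` from a point of `Ω`. -/
def boundary {N : ℕ} (Ω : Set (EuclideanSpace ℝ (Fin N))) (δ : ENNReal) :
    Set (EuclideanSpace ℝ (Fin N)) :=
  {y | y ∉ Ω ∧ ∃ x ∈ Ω, edist x y < δ}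

/-- The nonlocally completed domain `Ω_δ = Ω ∪ ∂_δ Ω`. -/
def domain {N : ℕ} (Ω : Set (EuclideanSpace ℝ (Fin N))) (δ : ENNReal) :
    Set (EuclideanSpace ℝ (Fin N)) :=
  Ω ∪ boundary Ω δ

lemma boundary_top {N : ℕ} {Ω : Set (EuclideanSpace ℝ (Fin N))} (h : Ω.Nonempty) :
    boundary Ω ⊤ = Ωᶜ := by
  obtain ⟨x, hx⟩ := h
  ext y
  simp only [boundary, mem_setOf_eq, mem_compl_iff, and_iff_left_iff_imp]
  exact fun _ => ⟨x, hx, edist_lt_top x y⟩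

lemma domain_top {N : ℕ} {Ω : Set (EuclideanSpace ℝ (Fin N))} (h : Ω.Nonempty) :
    domain Ω ⊤ = univ := by
  rw [domain, boundary_top h, union_compl_self]

/-- The pairs `(x, y)` with `x ∈ Ω_δ` and `y ∈ Ω_δ ∩ B(x, δ)`. -/
def interaction {N : ℕ} (Ω : Set (EuclideanSpace ℝ (Fin N))) (δ : ENNReal) :
    Set (EuclideanSpace ℝ (Fin N) × EuclideanSpace ℝ (Fin N)) :=
  {p | p.1 ∈ domain Ω δ ∧ p.2 ∈ domain Ω δ ∧ edist p.1 p.2 < δ}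

/-- The integrand `(u(x) - u(y)) (v(x) - v(y)) / |x - y|^(N + 2s)`. -/
def integrand {N : ℕ} (s : ℝ) (u v : EuclideanSpace ℝ (Fin N) → ℝ)
    (p : EuclideanSpace ℝ (Fin N) × EuclideanSpace ℝ (Fin N)) : ℝ :=
  (u p.1 - u p.2) * (v p.1 - v p.2) / ‖p.1 - p.2‖ ^ ((N : ℝ) + 2 * s)

/-- The bilinear form
`⟨u, v⟩ = ∫_{Ω_δ} ∫_{Ω_δ ∩ B(x, δ)} (u(x) - u(y)) (v(x) - v(y)) / |x - y|^(N + 2s) dy dx`. -/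
def form {N : ℕ} (s : ℝ) (Ω : Set (EuclideanSpace ℝ (Fin N))) (δ : ENNReal)
    (u v : EuclideanSpace ℝ (Fin N) → ℝ) : ℝ :=
  ∫ p in interaction Ω δ, integrand s u v p ∂(volume.prod volume)

/-- Membership in the energy space `ℍ₀^{δ,s}(Ω)`: `u` is square integrable on `Ω_δ`, vanishes almost
everywhere on `∂_δ Ω`, and `⟨u, u⟩` is finite. Values of `u` outside `Ω_δ` play no role. -/
structure MemEnergySpace {N : ℕ} (s : ℝ) (Ω : Set (EuclideanSpace ℝ (Fin N))) (δ : ENNReal)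
    (u : EuclideanSpace ℝ (Fin N) → ℝ) : Prop where
  memLp : MemLp u 2 (volume.restrict (domain Ω δ))
  eq_zero : ∀ᵐ y ∂volume, y ∈ boundary Ω δ → u y = 0
  finite_energy : IntegrableOn (integrand s u u) (interaction Ω δ) (volume.prod volume)

/-- The normalization constant `c_{N,s}` of the fractional Laplacian. -/
def normConst (N : ℕ) (s : ℝ) : ℝ :=
  2 ^ (2 * s) * s * Real.Gamma ((N : ℝ) / 2 + s) /
    (Real.pi ^ ((N : ℝ) / 2) * Real.Gamma (1 - s))

/-- `u` is a weak solution of `(-Δ)_δ^s u = μ u` in `Ω`, `u = 0` on `∂_δ Ω`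
(`u = 0` is allowed here). -/
def IsWeakEigenfunction {N : ℕ} (s : ℝ) (Ω : Set (EuclideanSpace ℝ (Fin N))) (δ : ENNReal)
    (μ : ℝ) (u : EuclideanSpace ℝ (Fin N) → ℝ) : Prop :=
  MemEnergySpace s Ω δ u ∧ ∀ v, MemEnergySpace s Ω δ v →
    normConst N s / 2 * form s Ω δ u v = μ * ∫ x in Ω, u x * v x

section Helper

variable {N : ℕ} {s : ℝ} {Ω : Set (EuclideanSpace ℝ (Fin N))} {δ : ENNReal}

lemma MemEnergySpace.zero : MemEnergySpace s Ω δ (fun _ => 0) := by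
  refine ⟨MemLp.zero', by simp, ?_⟩
  have : integrand (N := N) s (fun _ => 0) (fun _ => 0) = fun _ => 0 := by
    funext p; simp [integrand]
  rw [this]
  exact integrableOn_zero

lemma MemEnergySpace.aesm_diff {u : EuclideanSpace ℝ (Fin N) → ℝ} (hu : MemEnergySpace s Ω δ u) :
    AEStronglyMeasurable (fun p : EuclideanSpace ℝ (Fin N) × EuclideanSpace ℝ (Fin N) =>
      u p.1 - u p.2) ((volume.prod volume).restrict (interaction Ω δ)) := by
  have h := hu.memLp.aestronglyMeasurable
  have h1 : AEStronglyMeasurable (fun p : EuclideanSpace ℝ (Fin N) × EuclideanSpace ℝ (Fin N) =>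
      u p.1 - u p.2)
      ((volume.restrict (domain Ω δ)).prod (volume.restrict (domain Ω δ))) :=
    h.comp_fst.sub h.comp_snd
  rw [Measure.prod_restrict] at h1
  have hsub : interaction Ω δ ⊆ domain Ω δ ×ˢ domain Ω δ := fun p hp => ⟨hp.1, hp.2.1⟩
  exact h1.mono_measure (Measure.restrict_mono hsub le_rfl)

lemma MemEnergySpace.integrable {u v : EuclideanSpace ℝ (Fin N) → ℝ}
    (hu : MemEnergySpace s Ω δ u) (hv : MemEnergySpace s Ω δ v) :
    IntegrableOn (integrand s u v) (interaction Ω δ) (volume.prod volume) := by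
  refine Integrable.mono' (hu.finite_energy.add hv.finite_energy) ?_ ?_
  · have hk : Measurable (fun p : EuclideanSpace ℝ (Fin N) × EuclideanSpace ℝ (Fin N) =>
        (‖p.1 - p.2‖ ^ ((N : ℝ) + 2 * s))⁻¹) := by fun_prop
    have := (hu.aesm_diff.mul hv.aesm_diff).mul hk.aestronglyMeasurable
    exact this
  · refine Eventually.of_forall fun p => ?_
    have hw : 0 ≤ ‖p.1 - p.2‖ ^ ((N : ℝ) + 2 * s) := by positivity
    simp only [integrand, Pi.add_apply, Real.norm_eq_abs, abs_div, abs_of_nonneg hw, ← add_div]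
    refine div_le_div_of_nonneg_right ?_ hw
    rw [abs_le]
    constructor <;>
      nlinarith [sq_nonneg (u p.1 - u p.2 + (v p.1 - v p.2)),
        sq_nonneg (u p.1 - u p.2 - (v p.1 - v p.2)), sq_nonneg (u p.1 - u p.2),
        sq_nonneg (v p.1 - v p.2)]

lemma MemEnergySpace.add {u v : EuclideanSpace ℝ (Fin N) → ℝ}
    (hu : MemEnergySpace s Ω δ u) (hv : MemEnergySpace s Ω δ v) :
    MemEnergySpace s Ω δ (fun x => u x + v x) := by
  refine ⟨hu.memLp.add hv.memLp, ?_, ?_⟩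
  · filter_upwards [hu.eq_zero, hv.eq_zero] with y h1 h2 hy
    simp [h1 hy, h2 hy]
  · have h := ((hu.finite_energy.add hv.finite_energy).add (hu.integrable hv)).add
      (hu.integrable hv)
    refine h.congr (Eventually.of_forall fun p => ?_)
    simp only [integrand, Pi.add_apply]
    ring

lemma MemEnergySpace.smul {u : EuclideanSpace ℝ (Fin N) → ℝ} (c : ℝ)
    (hu : MemEnergySpace s Ω δ u) : MemEnergySpace s Ω δ (fun x => c * u x) := by
  refine ⟨hu.memLp.const_mul c, ?_, ?_⟩
  · filter_upwards [hu.eq_zero] with y h1 hy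
    simp [h1 hy]
  · refine (hu.finite_energy.const_mul (c * c)).congr (Eventually.of_forall fun p => ?_)
    simp only [integrand]
    ring

lemma MemEnergySpace.memLp_Ω {u : EuclideanSpace ℝ (Fin N) → ℝ} (hu : MemEnergySpace s Ω δ u) :
    MemLp u 2 (volume.restrict Ω) :=
  hu.memLp.mono_measure (Measure.restrict_mono subset_union_left le_rfl)

lemma IsWeakEigenfunction.zero {μ : ℝ} : IsWeakEigenfunction s Ω δ μ (fun _ => 0) := by
  refine ⟨MemEnergySpace.zero, fun v _ => ?_⟩
  simp [form, integrand]

lemma IsWeakEigenfunction.add {μ : ℝ} {u w : EuclideanSpace ℝ (Fin N) → ℝ}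
    (hu : IsWeakEigenfunction s Ω δ μ u) (hw : IsWeakEigenfunction s Ω δ μ w) :
    IsWeakEigenfunction s Ω δ μ (fun x => u x + w x) := by
  refine ⟨hu.1.add hw.1, fun v hv => ?_⟩
  have h1 : form s Ω δ (fun x => u x + w x) v = form s Ω δ u v + form s Ω δ w v := by
    unfold form
    rw [← integral_add (hu.1.integrable hv) (hw.1.integrable hv)]
    refine integral_congr_ae (Eventually.of_forall fun p => ?_)
    simp only [integrand]
    ring
  have h2 : ∫ x in Ω, (u x + w x) * v x = (∫ x in Ω, u x * v x) + ∫ x in Ω, w x * v x := by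
    refine Eq.trans (integral_congr_ae (Eventually.of_forall fun x => ?_))
      (integral_add (hu.1.memLp_Ω.integrable_mul hv.memLp_Ω)
        (hw.1.memLp_Ω.integrable_mul hv.memLp_Ω))
    ring
  rw [h1, h2, mul_add, mul_add, hu.2 v hv, hw.2 v hv]

lemma IsWeakEigenfunction.smul {μ : ℝ} (c : ℝ) {u : EuclideanSpace ℝ (Fin N) → ℝ}
    (hu : IsWeakEigenfunction s Ω δ μ u) : IsWeakEigenfunction s Ω δ μ (fun x => c * u x) := by
  refine ⟨hu.1.smul c, fun v hv => ?_⟩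
  have h1 : form s Ω δ (fun x => c * u x) v = c * form s Ω δ u v := by
    unfold form
    rw [← integral_const_mul]
    refine integral_congr_ae (Eventually.of_forall fun p => ?_)
    simp only [integrand]
    ring
  have h2 : ∫ x in Ω, c * u x * v x = c * ∫ x in Ω, u x * v x := by
    rw [← integral_const_mul]
    refine integral_congr_ae (Eventually.of_forall fun p => ?_)
    simp only []
    ring
  rw [h1, h2, mul_left_comm, hu.2 v hv, mul_left_comm]

end Helper

/-- The eigenspace for `μ` of `(-Δ)_δ^s` with `u = 0` on `∂_δ Ω`, as a subspace of `L²(Ω)`: the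
restrictions to `Ω` of the weak solutions. -/
def eigenspace {N : ℕ} (s : ℝ) (Ω : Set (EuclideanSpace ℝ (Fin N))) (δ : ENNReal) (μ : ℝ) :
    Submodule ℝ (Lp ℝ 2 (volume.restrict Ω)) where
  carrier := {f | ∃ u, IsWeakEigenfunction s Ω δ μ u ∧ f =ᵐ[volume.restrict Ω] u}
  zero_mem' := ⟨fun _ => 0, IsWeakEigenfunction.zero, Lp.coeFn_zero _ _ _⟩
  add_mem' := by
    rintro f g ⟨u, hu, hfu⟩ ⟨w, hw, hgw⟩
    refine ⟨_, hu.add hw, ?_⟩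
    filter_upwards [Lp.coeFn_add f g, hfu, hgw] with x h1 h2 h3
    rw [h1, Pi.add_apply, h2, h3]
  smul_mem' := by
    rintro c f ⟨u, hu, hfu⟩
    refine ⟨_, hu.smul c, ?_⟩
    filter_upwards [Lp.coeFn_smul c f, hfu] with x h1 h2
    rw [h1, Pi.smul_apply, h2, smul_eq_mul]

/-- The eigenvalue `λ_{k+1}^{δ,s}` (counting starts at `k = 0`), the eigenvalues being listed in
nondecreasing order and repeated according to multiplicity: the least `t` such that the
eigenspaces of the eigenvalues `≤ t` together have dimension at least `k + 1`. -/
def eigenvalue {N : ℕ} (s : ℝ) (Ω : Set (EuclideanSpace ℝ (Fin N))) (δ : ENNReal) (k : ℕ) : ℝ :=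
  sInf {t : ℝ | ((k + 1 : ℕ) : Cardinal) ≤
    Module.rank ℝ ↥(⨆ μ ∈ Iic t, eigenspace s Ω δ μ : Submodule ℝ (Lp ℝ 2 (volume.restrict Ω)))}

/-- The multiplicity of the eigenvalue `λ_{k+1}^{δ,s}`. -/
def multiplicity {N : ℕ} (s : ℝ) (Ω : Set (EuclideanSpace ℝ (Fin N))) (δ : ENNReal) (k : ℕ) : ℕ :=
  Module.finrank ℝ (eigenspace s Ω δ (eigenvalue s Ω δ k))

/-- `φ` is an orthonormal basis of `L²(Ω)` such that `φ k` is an eigenfunction for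
`λ_{k+1}^{δ,s}`. -/
structure IsEigenbasis {N : ℕ} (s : ℝ) (Ω : Set (EuclideanSpace ℝ (Fin N))) (δ : ENNReal)
    (φ : ℕ → Lp ℝ 2 (volume.restrict Ω)) : Prop where
  orthonormal : Orthonormal ℝ φ
  complete : (Submodule.span ℝ (range φ)).topologicalClosure = ⊤
  mem_eigenspace : ∀ k, φ k ∈ eigenspace s Ω δ (eigenvalue s Ω δ k)

end

end FiniteHorizon

/-! Once the horizon `r` exceeds the distance between any two points of Ω, the finite and infinite
horizon operators differ by a multiple of the identity. Take `u`, `v` vanishing outside Ω. A pair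
with `|x - y| ≥ r` has at least one point outside Ω, so the product of differences reduces to
`u(x)v(x) + u(y)v(y)` (`integrand_eq_add_tailKernel`). Integrating this against the kernel, by
Fubini and translation invariance, gives `2⟪u, v⟫ ∫ tailKernel` (`form_top_eq`). Hence the
eigenspaces are the same for both horizons and every eigenvalue is shifted by `c_{N,s} ∫ tailKernel`
(`eigenspace_ofReal_eq`, `eigenvalue_ofReal_eq`). The shift tends to 0 as `r → ∞`, which gives the
convergence of eigenvalues, and the multiplicities are eventually constant. For large horizons the
k-th eigenfunctions all lie in one fixed finite-dimensional eigenspace, so compactness of unit balls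
and Tychonoff's theorem yield the convergent subsequence.

The other half is the well-posedness of the spectrum for each fixed horizon,
`discreteSpectrum_eigenspace`. The energy space is a Hilbert space, as the closed graph of the
difference quotient operator. It embeds densely in L²(Ω), because it contains the smooth functions
with compact support in Ω, and compactly, because averaging over small cubes approximates its
elements with an error controlled by the energy. The spectral theorem for `J ∘ J.adjoint`, with `J`
the embedding, makes the eigenvectors complete. Positivity holds because a function of zero energy
is periodic with bounded support. The passage from eigenspaces to an ordered list of eigenvalues is
abstract and rests on `DiscreteSpectrum.level_eq_iff`. -/

namespace FiniteHorizon

/-! ### Compact embeddings of Hilbert spaces and their variational eigenvectors. -/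

section Embedding

variable {E H : Type*} [NormedAddCommGroup E] [InnerProductSpace ℝ E] [NormedAddCommGroup H]
  [InnerProductSpace ℝ H]

/-- A bounded operator which is approximated, in operator norm, by operators of finite rank. -/
def FiniteRankApproximable (J : H →L[ℝ] E) : Prop :=
  ∀ ε : ℝ, 0 < ε → ∃ V : Submodule ℝ E, FiniteDimensional ℝ V ∧
    ∀ u : H, ∃ v ∈ V, ‖J u - v‖ ≤ ε * ‖u‖

/-- The orthogonal projection onto the approximating subspace is at least as good as any other
choice of approximant, so `J` is an operator-norm limit of its compositions with finite-rank
projections. -/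
lemma FiniteRankApproximable.isCompactOperator [CompleteSpace E] {J : H →L[ℝ] E}
    (hJ : FiniteRankApproximable J) : IsCompactOperator J := by
  choose! V hV hVJ using hJ
  have hpos : ∀ n : ℕ, (0 : ℝ) < 1 / (n + 1) := fun n => Nat.one_div_pos_of_nat
  have : ∀ n : ℕ, FiniteDimensional ℝ (V (1 / (n + 1))) := fun n => hV _ (hpos n)
  refine isCompactOperator_of_tendsto (l := atTop)
    (F := fun n : ℕ => (V (1 / (n + 1))).starProjection ∘L J) ?_ (Eventually.of_forall fun n => ?_)
  · rw [tendsto_iff_norm_sub_tendsto_zero]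
    refine squeeze_zero (fun _ => norm_nonneg _) (fun n => ?_) tendsto_one_div_add_atTop_nhds_zero_nat
    refine ContinuousLinearMap.opNorm_le_bound _ (hpos n).le fun u => ?_
    obtain ⟨v, hv, hle⟩ := hVJ _ (hpos n) u
    refine le_trans ?_ hle
    simp only [sub_apply, ContinuousLinearMap.comp_apply]
    rw [norm_sub_rev, Submodule.starProjection_minimal]
    exact ciInf_le ⟨0, by rintro _ ⟨w, rfl⟩; exact norm_nonneg _⟩ (⟨v, hv⟩ : V (1 / (n + 1)))
  · have h : IsCompactOperator (V (1 / ((n : ℝ) + 1))).subtypeL :=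
      isCompactOperator_of_locallyCompactSpace_rng (V (1 / ((n : ℝ) + 1))).subtypeL
    exact h.comp_clm ((V (1 / ((n : ℝ) + 1))).orthogonalProjectionOnto ∘L J)

/-- A subspace on which a finite-rank-approximable operator has a bounded right inverse is
finite-dimensional. -/
lemma FiniteRankApproximable.finiteDimensional {J : H →L[ℝ] E}
    (hJ : FiniteRankApproximable J) (S : Submodule ℝ E) (C : ℝ)
    (hS : ∀ f ∈ S, ∃ u, J u = f ∧ ‖u‖ ≤ C * ‖f‖) : FiniteDimensional ℝ S := by
  have hC : 0 < |C| + 1 := by positivity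
  -- This accuracy forces a vector of `S` orthogonal to `V` to satisfy `‖f‖ ≤ ‖f‖ / 2`, so
  -- projection to `V` is injective on `S`.
  obtain ⟨V, hV, hVJ⟩ := hJ (1 / (2 * (|C| + 1))) (by positivity)
  refine Module.Finite.of_injective
    ((V.orthogonalProjectionOnto : E →ₗ[ℝ] V) ∘ₗ S.subtype) ?_
  rw [← LinearMap.ker_eq_bot, LinearMap.ker_eq_bot']
  rintro ⟨f, hf⟩ h0
  have h0 : V.orthogonalProjectionOnto f = 0 := h0
  have hperp : f ∈ Vᗮ := Submodule.orthogonalProjectionOnto_eq_zero_iff.1 h0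
  obtain ⟨u, rfl, hu⟩ := hS f hf
  obtain ⟨v, hv, hle⟩ := hVJ u
  have h1 : ‖J u‖ ≤ ‖J u - v‖ := by
    have h2 : inner ℝ (J u) v = 0 := Submodule.inner_left_of_mem_orthogonal hv hperp
    have h3 := norm_sub_sq_real (J u) v
    rw [h2] at h3
    nlinarith [norm_nonneg (J u), norm_nonneg (J u - v), sq_nonneg ‖v‖]
  have h2 : ‖u‖ ≤ (|C| + 1) * ‖J u‖ :=
    hu.trans (mul_le_mul_of_nonneg_right (by linarith [le_abs_self C]) (norm_nonneg _))
  have h3 : 1 / (2 * (|C| + 1)) * ‖u‖ ≤ 1 / 2 * ‖J u‖ := by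
    calc 1 / (2 * (|C| + 1)) * ‖u‖ ≤ 1 / (2 * (|C| + 1)) * ((|C| + 1) * ‖J u‖) := by gcongr
      _ = 1 / 2 * ‖J u‖ := by field_simp
  have h4 : ‖J u‖ = 0 := le_antisymm (by linarith) (norm_nonneg _)
  exact Subtype.ext (norm_eq_zero.1 h4)

/-- The spectral theorem for the variational eigenvalue problem `⟪u, v⟫ = r ⟪J u, J v⟫` of a compact
embedding with dense range: the eigenvectors span a dense subspace. -/
lemma topologicalClosure_eq_top_of_eigenvectors [CompleteSpace E] [CompleteSpace H] {J : H →L[ℝ] E}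
    (hJ : IsCompactOperator J) (hd : ∀ e : E, (∀ u, inner ℝ e (J u) = 0) → e = 0)
    (S : Submodule ℝ E)
    (hS : ∀ (u : H) (r : ℝ), (∀ v, inner ℝ u v = r * inner ℝ (J u) (J v)) → J u ∈ S) :
    S.topologicalClosure = ⊤ := by
  -- If `T e = κ e` with `κ ≠ 0`, then `κ⁻¹ J* e` is a preimage of `e` under `J` and solves the
  -- variational problem with `r = κ⁻¹`. If `κ = 0`, then `‖J* e‖² = ⟪T e, e⟫ = 0`, and density of
  -- the range gives `e = 0`.
  set T : E →L[ℝ] E := J ∘L J.adjoint with hT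
  have hTc : IsCompactOperator T := hJ.comp_clm _
  have hTs : T.IsSymmetric := by
    intro x y
    change inner ℝ (J (J.adjoint x)) y = inner ℝ x (J (J.adjoint y))
    rw [← ContinuousLinearMap.adjoint_inner_right, ContinuousLinearMap.adjoint_inner_left]
  rw [Submodule.topologicalClosure_eq_top_iff, eq_bot_iff,
    ← ContinuousLinearMap.orthogonalComplement_iSup_eigenspaces_eq_bot hTc hTs]
  refine Submodule.orthogonal_le (iSup_le fun κ e he => ?_)
  have he : J (J.adjoint e) = κ • e := Module.End.mem_eigenspace_iff.1 he
  by_cases hκ : κ = 0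
  · have h0 : J.adjoint e = 0 := by
      rw [← inner_self_eq_zero (𝕜 := ℝ), ContinuousLinearMap.adjoint_inner_left, he, hκ]
      simp
    have : e = 0 := hd e fun u => by
      rw [← ContinuousLinearMap.adjoint_inner_left, h0, inner_zero_left]
    rw [this]
    exact S.zero_mem
  · have h1 : J (κ⁻¹ • J.adjoint e) = e := by
      rw [map_smul, he, smul_smul, inv_mul_cancel₀ hκ, one_smul]
    have h2 := hS (κ⁻¹ • J.adjoint e) κ⁻¹ fun v => by
      rw [h1, real_inner_smul_left, ContinuousLinearMap.adjoint_inner_left]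
    rwa [h1] at h2

end Embedding

/-! ### Ordered eigenvalues of an abstract discrete family of eigenspaces. -/

section DiscreteSpectrum

variable {E : Type*} [NormedAddCommGroup E] [InnerProductSpace ℝ E]

/-- The eigenspaces `W μ` of a positive operator with compact resolvent. -/
structure DiscreteSpectrum (W : ℝ → Submodule ℝ E) : Prop where
  ortho : ∀ μ ν, μ ≠ ν → W μ ⟂ W ν
  pos : ∀ μ, W μ ≠ ⊥ → 0 < μ
  fin : ∀ t, FiniteDimensional ℝ (⨆ μ ∈ Iic t, W μ : Submodule ℝ E)
  dense : (⨆ μ, W μ).topologicalClosure = ⊤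

/-- The eigenvalues, in nondecreasing order and repeated according to multiplicity. -/
noncomputable def level (W : ℝ → Submodule ℝ E) (k : ℕ) : ℝ :=
  sInf {t : ℝ | ((k + 1 : ℕ) : Cardinal) ≤ Module.rank ℝ (⨆ μ ∈ Iic t, W μ : Submodule ℝ E)}

/-- The number of eigenvalues less than `t`, counted with multiplicity. -/
noncomputable def countBelow (W : ℝ → Submodule ℝ E) (t : ℝ) : ℕ :=
  Module.finrank ℝ (⨆ μ ∈ Iio t, W μ : Submodule ℝ E)

namespace DiscreteSpectrum

variable {W : ℝ → Submodule ℝ E}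

lemma finiteDimensional_Iio (h : DiscreteSpectrum W) (t : ℝ) :
    FiniteDimensional ℝ (⨆ μ ∈ Iio t, W μ : Submodule ℝ E) :=
  have := h.fin t
  Submodule.finiteDimensional_of_le (S₂ := ⨆ μ ∈ Iic t, W μ)
    (biSup_mono fun _ hi => mem_Iic.2 (mem_Iio.1 hi).le)

lemma finiteDimensional (h : DiscreteSpectrum W) (t : ℝ) : FiniteDimensional ℝ (W t) :=
  have := h.fin t
  Submodule.finiteDimensional_of_le (le_biSup W (mem_Iic.2 (le_refl t)))

lemma mem_level_set_iff (h : DiscreteSpectrum W) (k : ℕ) (t : ℝ) :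
    ((k + 1 : ℕ) : Cardinal) ≤ Module.rank ℝ (⨆ μ ∈ Iic t, W μ : Submodule ℝ E) ↔
      k < Module.finrank ℝ (⨆ μ ∈ Iic t, W μ : Submodule ℝ E) := by
  have := h.fin t
  rw [← Module.finrank_eq_rank, Nat.cast_le, Nat.succ_le_iff]

lemma finrank_Iic (h : DiscreteSpectrum W) (t : ℝ) :
    Module.finrank ℝ (⨆ μ ∈ Iic t, W μ : Submodule ℝ E) =
      countBelow W t + Module.finrank ℝ (W t) := by
  have := h.finiteDimensional_Iio t
  have := h.finiteDimensional t
  have h1 : (⨆ μ ∈ Iic t, W μ) = (⨆ μ ∈ Iio t, W μ) ⊔ W t := by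
    rw [← Iio_insert, iSup_insert, sup_comm]
  have h2 : (⨆ μ ∈ Iio t, W μ) ⊓ W t = ⊥ := by
    have : (⨆ μ ∈ Iio t, W μ) ⟂ W t :=
      Submodule.isOrtho_iSup_left.2 fun μ => Submodule.isOrtho_iSup_left.2 fun hμ =>
        h.ortho _ _ (ne_of_lt hμ)
    exact this.disjoint.eq_bot
  have h3 := Submodule.finrank_sup_add_finrank_inf_eq (⨆ μ ∈ Iio t, W μ) (W t)
  rw [h2, finrank_bot, add_zero] at h3
  rw [h1, h3, countBelow]

lemma finrank_Iic_mono (h : DiscreteSpectrum W) {t t' : ℝ} (htt : t ≤ t') :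
    Module.finrank ℝ (⨆ μ ∈ Iic t, W μ : Submodule ℝ E) ≤
      Module.finrank ℝ (⨆ μ ∈ Iic t', W μ : Submodule ℝ E) :=
  have := h.fin t'
  Submodule.finrank_mono (biSup_mono fun _ hi => le_trans hi htt)

/-- Nonzero vectors chosen from distinct eigenspaces are orthogonal, hence independent, in a
finite-dimensional space. -/
lemma finite_setOf_ne_bot (h : DiscreteSpectrum W) (t : ℝ) : {μ | μ ≤ t ∧ W μ ≠ ⊥}.Finite := by
  have := h.fin t
  have hex : ∀ μ : {μ | μ ≤ t ∧ W μ ≠ ⊥}, ∃ e ∈ W μ, e ≠ 0 := fun μ =>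
    (Submodule.ne_bot_iff _).1 μ.2.2
  choose e he he0 using hex
  have hmem : ∀ μ, e μ ∈ (⨆ μ ∈ Iic t, W μ : Submodule ℝ E) := fun μ =>
    (le_biSup W (mem_Iic.2 μ.2.1)) (he μ)
  have hli : LinearIndependent ℝ
      (fun μ => (⟨e μ, hmem μ⟩ : (⨆ μ ∈ Iic t, W μ : Submodule ℝ E))) := by
    refine linearIndependent_of_ne_zero_of_inner_eq_zero (fun μ h0 => he0 μ ?_) fun μ ν hμν => ?_
    · exact congrArg Subtype.val h0
    · exact (h.ortho μ ν fun hh => hμν (Subtype.ext hh)).inner_eq (he μ) (he ν)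
  exact Set.finite_coe_iff.1 hli.finite

lemma eventually_eq_bot (h : DiscreteSpectrum W) (t : ℝ) :
    ∃ ε > 0, ∀ μ, |μ - t| < ε → μ ≠ t → W μ = ⊥ := by
  have h1 := ((h.finite_setOf_ne_bot (t + 1)).subset
    (sdiff_subset (t := {t}))).isClosed.isOpen_compl.mem_nhds (x := t) (by simp)
  obtain ⟨ε, hε, hsub⟩ := Metric.mem_nhds_iff.1 h1
  -- The cap at 1 keeps `μ` below `t + 1`, the range in which finiteness is used.
  refine ⟨min ε 1, by positivity, fun μ hμ hne => ?_⟩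
  by_contra hb
  refine hsub (a := μ) ?_ ⟨⟨?_, hb⟩, hne⟩
  · rw [Metric.mem_ball, Real.dist_eq]
    exact hμ.trans_le (min_le_left _ _)
  · linarith [(abs_lt.1 (hμ.trans_le (min_le_right _ _))).2]

/-- If the dimensions stayed bounded, a subspace of maximal dimension would contain every
eigenspace. Being finite-dimensional it is closed, so density would make it the whole space. -/
lemma exists_lt_finrank_Iic (h : DiscreteSpectrum W) (hE : ¬ FiniteDimensional ℝ E) (k : ℕ) :
    ∃ t, k < Module.finrank ℝ (⨆ μ ∈ Iic t, W μ : Submodule ℝ E) := by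
  by_contra! hcon
  set n : ℝ → ℕ := fun t => Module.finrank ℝ (⨆ μ ∈ Iic t, W μ : Submodule ℝ E) with hn
  have hbdd : BddAbove (range n) := ⟨k, by rintro _ ⟨t, rfl⟩; exact hcon t⟩
  obtain ⟨T, hT⟩ := Nat.sSup_mem (range_nonempty n) hbdd
  have := h.fin T
  have hle : ∀ t, W t ≤ (⨆ μ ∈ Iic T, W μ : Submodule ℝ E) := by
    intro t
    have := h.fin (max t T)
    have h1 : (⨆ μ ∈ Iic T, W μ : Submodule ℝ E) = ⨆ μ ∈ Iic (max t T), W μ :=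
      Submodule.eq_of_le_of_finrank_le (biSup_mono fun _ hi => mem_Iic.2 ((mem_Iic.1 hi).trans (le_max_right _ _)))
        (by
          change n (max t T) ≤ n T
          rw [hT]
          exact le_csSup hbdd ⟨_, rfl⟩)
    rw [h1]
    exact le_biSup W (mem_Iic.2 (le_max_left t T))
  have htop : (⨆ μ ∈ Iic T, W μ : Submodule ℝ E) = ⊤ := by
    have hcl := (⨆ μ ∈ Iic T, W μ : Submodule ℝ E).closed_of_finiteDimensional
    rw [eq_top_iff, ← h.dense]
    exact Submodule.topologicalClosure_minimal _ (iSup_le hle) hcl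
  refine hE ?_
  rw [htop] at this
  exact Module.finite_def.2 (Module.Finite.iff_fg.1 this)

/-- The indices belonging to the eigenvalue `μ` form a block of length `finrank (W μ)` starting at
`countBelow W μ`. Since the spectrum is isolated, the infimum defining `level` is attained. All
later facts on `level` come from this description. -/
lemma level_eq_iff (h : DiscreteSpectrum W) (hE : ¬ FiniteDimensional ℝ E) (k : ℕ) (μ : ℝ) :
    level W k = μ ↔ countBelow W μ ≤ k ∧ k < countBelow W μ + Module.finrank ℝ (W μ) := by
  have hset : level W k =
      sInf {t | k < Module.finrank ℝ (⨆ μ ∈ Iic t, W μ : Submodule ℝ E)} :=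
    congrArg sInf (Set.ext fun t => h.mem_level_set_iff k t)
  set A := {t | k < Module.finrank ℝ (⨆ μ ∈ Iic t, W μ : Submodule ℝ E)} with hA
  constructor
  · intro hμ
    obtain ⟨ε, hε, hbot⟩ := h.eventually_eq_bot μ
    have hne : A.Nonempty := h.exists_lt_finrank_Iic hE k
    -- Needed for the real `sInf` to be a genuine infimum; there are no eigenvalues below 0.
    have hbelow : BddBelow A := by
      refine ⟨0, fun t ht => ?_⟩
      by_contra! hneg
      have : (⨆ μ ∈ Iic t, W μ : Submodule ℝ E) = ⊥ := by
        refine iSup_eq_bot.2 fun ν => iSup_eq_bot.2 fun hν => ?_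
        by_contra hb
        exact absurd (h.pos ν hb) (not_lt.2 ((mem_Iic.1 hν).trans hneg.le))
      rw [hA, mem_ofPred_eq, this, finrank_bot] at ht
      exact Nat.not_lt_zero _ ht
    rw [hset] at hμ
    constructor
    -- No eigenvalue lies in `(μ - ε, μ)`, so counting up to `μ - ε / 2` is the same as counting
    -- strictly below `μ`.
    · have h1 : μ - ε / 2 ∉ A := fun hmem => by
        have := csInf_le hbelow hmem
        linarith
      have h2 : k ≥ Module.finrank ℝ (⨆ ν ∈ Iic (μ - ε / 2), W ν : Submodule ℝ E) :=
        not_lt.1 h1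
      refine le_trans ?_ h2
      have := h.fin (μ - ε / 2)
      refine Submodule.finrank_mono (iSup₂_le fun ν hν => ?_)
      have hν : ν < μ := hν
      by_cases hc : ν ≤ μ - ε / 2
      · exact le_biSup W (mem_Iic.2 hc)
      · rw [hbot ν (by rw [abs_lt]; constructor <;> linarith) hν.ne]
        exact bot_le
    · rw [← h.finrank_Iic]
      -- No eigenvalue lies in `(μ, μ + ε)`, so the space for this `t` is contained in the one for
      -- `μ`.
      obtain ⟨t, ht, htlt⟩ := exists_lt_of_csInf_lt hne (show sInf A < μ + ε by linarith)
      refine lt_of_lt_of_le ht ?_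
      have := h.fin μ
      refine Submodule.finrank_mono (iSup₂_le fun ν hν => ?_)
      have hν : ν ≤ t := hν
      by_cases hc : ν ≤ μ
      · exact le_biSup W (mem_Iic.2 hc)
      · rw [hbot ν (by rw [abs_lt]; constructor <;> linarith) (by intro hh; exact hc hh.le)]
        exact bot_le
  · rintro ⟨h1, h2⟩
    rw [hset]
    refine IsLeast.csInf_eq ⟨?_, fun t ht => ?_⟩
    · rw [hA, mem_ofPred_eq, h.finrank_Iic]
      exact h2
    · by_contra! hlt
      refine absurd (lt_of_lt_of_le ht ?_) (not_lt.2 h1)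
      have := h.finiteDimensional_Iio μ
      exact Submodule.finrank_mono (biSup_mono fun _ hi => lt_of_le_of_lt hi hlt)

lemma finrank_level_pos (h : DiscreteSpectrum W) (hE : ¬ FiniteDimensional ℝ E) (k : ℕ) :
    0 < Module.finrank ℝ (W (level W k)) := by
  have := (h.level_eq_iff hE k _).1 rfl
  omega

lemma level_pos (h : DiscreteSpectrum W) (hE : ¬ FiniteDimensional ℝ E) (k : ℕ) :
    0 < level W k := by
  refine h.pos _ fun hb => ?_
  have := h.finrank_level_pos hE k
  rw [hb, finrank_bot] at this
  exact lt_irrefl _ this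

lemma tendsto_level (h : DiscreteSpectrum W) (hE : ¬ FiniteDimensional ℝ E) :
    Tendsto (level W) atTop atTop := by
  refine tendsto_atTop.2 fun t => ?_
  filter_upwards [eventually_ge_atTop
    (Module.finrank ℝ (⨆ μ ∈ Iic t, W μ : Submodule ℝ E))] with k hk
  by_contra! hlt
  have h1 := ((h.level_eq_iff hE k _).1 rfl).2
  rw [← h.finrank_Iic] at h1
  exact absurd (h1.trans_le (h.finrank_Iic_mono hlt.le)) (not_lt.2 hk)

/-- Orthonormal eigenvectors for all the eigenvalues are complete. -/
lemma complete_of_orthonormal (h : DiscreteSpectrum W) (hE : ¬ FiniteDimensional ℝ E) {ψ : ℕ → E}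
    (ho : Orthonormal ℝ ψ) (hψ : ∀ k, ψ k ∈ W (level W k)) :
    (Submodule.span ℝ (range ψ)).topologicalClosure = ⊤ := by
  rw [eq_top_iff, ← h.dense]
  refine Submodule.topologicalClosure_mono (iSup_le fun μ => ?_)
  have := h.finiteDimensional μ
  -- The block of indices belonging to `μ` supplies exactly `finrank (W μ)` independent vectors of
  -- `W μ`, hence a basis of it.
  set v : Fin (Module.finrank ℝ (W μ)) → E := fun i => ψ (countBelow W μ + i) with hv
  have hli : LinearIndependent ℝ v :=
    ho.linearIndependent.comp (fun i : Fin (Module.finrank ℝ (W μ)) => countBelow W μ + (i : ℕ))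
      fun i j hij => Fin.ext (by simpa using hij)
  have hle : Submodule.span ℝ (range v) ≤ W μ := by
    rw [Submodule.span_le]
    rintro _ ⟨i, rfl⟩
    have hl : level W (countBelow W μ + i) = μ :=
      (h.level_eq_iff hE _ _).2 ⟨by omega, by omega⟩
    have := hψ (countBelow W μ + i)
    rwa [hl] at this
  have heq : Submodule.span ℝ (range v) = W μ :=
    Submodule.eq_of_le_of_finrank_eq hle (by rw [finrank_span_eq_card hli, Fintype.card_fin])
  rw [← heq]
  refine Submodule.span_mono ?_
  rintro _ ⟨i, rfl⟩
  exact ⟨_, rfl⟩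

lemma exists_orthonormal (h : DiscreteSpectrum W) (hE : ¬ FiniteDimensional ℝ E) :
    ∃ ψ : ℕ → E, Orthonormal ℝ ψ ∧ ∀ k, ψ k ∈ W (level W k) := by
  have := h.finiteDimensional
  let b : ∀ μ, OrthonormalBasis (Fin (Module.finrank ℝ (W μ))) ℝ (W μ) :=
    fun μ => stdOrthonormalBasis ℝ (W μ)
  -- Subtracting `countBelow W μ` gives the position of `k` within the block of `μ`. The default 0
  -- is never reached at `μ = level W k`.
  let g : ℝ → ℕ → E := fun μ k =>
    if hk : k - countBelow W μ < Module.finrank ℝ (W μ) then b μ ⟨k - countBelow W μ, hk⟩ else 0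
  have hg : ∀ μ k, g μ k ∈ W μ := by
    intro μ k
    simp only [g]
    split_ifs
    · exact Subtype.mem _
    · exact Submodule.zero_mem _
  refine ⟨fun k => g (level W k) k, ?_, fun k => hg _ _⟩
  rw [orthonormal_iff_ite]
  intro k l
  by_cases hkl : level W k = level W l
  · have h1 := (h.level_eq_iff hE k _).1 rfl
    have h2 := (h.level_eq_iff hE l _).1 rfl
    rw [hkl] at h1
    rw [hkl]
    generalize level W l = μ at h1 h2
    have hk : k - countBelow W μ < Module.finrank ℝ (W μ) := by omega
    have hl : l - countBelow W μ < Module.finrank ℝ (W μ) := by omega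
    simp only [g, dif_pos hk, dif_pos hl, ← Submodule.coe_inner]
    rw [orthonormal_iff_ite.1 (b μ).orthonormal]
    refine if_congr ?_ rfl rfl
    rw [Fin.mk.injEq]
    omega
  · rw [if_neg fun hh => hkl (congrArg _ hh)]
    exact (h.ortho _ _ hkl).inner_eq (hg _ _) (hg _ _)

/-- Sequences of systems of orthonormal eigenvectors are precompact. -/
lemma exists_subseq (h : DiscreteSpectrum W) {φ : ℕ → ℕ → E}
    (ho : ∀ n, Orthonormal ℝ (φ n)) (hφ : ∀ n k, φ n k ∈ W (level W k)) :
    ∃ σ : ℕ → ℕ, StrictMono σ ∧ ∃ ψ : ℕ → E, Orthonormal ℝ ψ ∧ (∀ k, ψ k ∈ W (level W k)) ∧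
      ∀ k, Tendsto (fun n => φ (σ n) k) atTop (𝓝 (ψ k)) := by
  have := h.finiteDimensional
  -- The product of these compact balls is sequentially compact, which extracts one subsequence for
  -- all `k` at once.
  let K : ℕ → Set E := fun k => (W (level W k)).subtypeL '' Metric.closedBall 0 1
  have hK : IsCompact (Set.pi univ K) := isCompact_univ_pi fun k =>
    (isCompact_closedBall _ _).image (W (level W k)).subtypeL.continuous
  have hmem : ∀ n, φ n ∈ Set.pi univ K := fun n k _ =>
    ⟨⟨φ n k, hφ n k⟩, by simpa using ((ho n).1 k).le, rfl⟩
  obtain ⟨ψ, hψ, σ, hσ, hlim⟩ := hK.isSeqCompact hmem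
  have hlim : ∀ k, Tendsto (fun n => φ (σ n) k) atTop (𝓝 (ψ k)) := fun k =>
    (tendsto_pi_nhds.1 hlim) k
  refine ⟨σ, hσ, ψ, ?_, fun k => ?_, hlim⟩
  · rw [orthonormal_iff_ite]
    intro k l
    refine tendsto_nhds_unique ((hlim k).inner (𝕜 := ℝ) (hlim l)) ?_
    refine tendsto_const_nhds.congr fun n => ?_
    rw [orthonormal_iff_ite.1 (ho (σ n))]
  · obtain ⟨w, -, hw⟩ := hψ k trivial
    rw [← hw]
    exact w.2

end DiscreteSpectrum

/-- A shift of the spectral parameter shifts the eigenvalues. -/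
lemma level_comp_add (W : ℝ → Submodule ℝ E) (a : ℝ) (h : DiscreteSpectrum W)
    (h' : DiscreteSpectrum fun μ => W (μ + a)) (hE : ¬ FiniteDimensional ℝ E) (k : ℕ) :
    level (fun μ => W (μ + a)) k = level W k - a := by
  rw [h'.level_eq_iff hE]
  have h1 := (h.level_eq_iff hE k _).1 rfl
  have h2 : countBelow (fun μ => W (μ + a)) (level W k - a) = countBelow W (level W k) := by
    have : (⨆ μ ∈ Iio (level W k - a), W (μ + a)) = ⨆ μ ∈ Iio (level W k), W μ := by
      refine le_antisymm (iSup₂_le fun μ hμ => ?_) (iSup₂_le fun μ hμ => ?_)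
      · refine le_biSup W (mem_Iio.2 ?_)
        have : μ < level W k - a := hμ
        linarith
      · refine le_trans (le_of_eq ?_) (le_biSup (fun μ => W (μ + a)) (i := μ - a) (mem_Iio.2 ?_))
        · simp
        · have : μ < level W k := hμ
          linarith
    unfold countBelow
    rw [this]
  rw [h2]
  rwa [sub_add_cancel]

end DiscreteSpectrum

/-! ### The energy space as a Hilbert space over L²(Ω). -/

section EnergySpace

variable {N : ℕ} {s : ℝ} {Ω : Set (EuclideanSpace ℝ (Fin N))} {δ : ENNReal}

lemma measurableSet_domain (hΩ : IsOpen Ω) : MeasurableSet (domain Ω δ) := by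
  have h1 : boundary Ω δ = Ωᶜ ∩ ⋃ x ∈ Ω, Metric.eball x δ := by
    ext y
    simp [boundary, edist_comm y]
  have h2 : IsOpen (⋃ x ∈ Ω, Metric.eball x δ) := isOpen_biUnion fun _ _ => Metric.isOpen_eball
  rw [domain, h1]
  exact hΩ.measurableSet.union (hΩ.measurableSet.compl.inter h2.measurableSet)

lemma measurableSet_interaction (hΩ : IsOpen Ω) : MeasurableSet (interaction Ω δ) :=
  (measurable_fst (measurableSet_domain hΩ)).inter
    ((measurable_snd (measurableSet_domain hΩ)).inter
      (measurableSet_lt (measurable_fst.edist measurable_snd) measurable_const))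

/-- A point within distance `δ` of Ω is in Ω_δ by definition, so the domain conditions are automatic
for pairs that meet Ω. The other pairs contribute nothing for functions vanishing off Ω. -/
lemma mem_interaction_of_mem {x y : EuclideanSpace ℝ (Fin N)} (h : x ∈ Ω ∨ y ∈ Ω)
    (hxy : edist x y < δ) : (x, y) ∈ interaction Ω δ := by
  have key : ∀ a b : EuclideanSpace ℝ (Fin N), a ∈ Ω → edist a b < δ → b ∈ domain Ω δ := by
    intro a b ha hab
    by_cases hb : b ∈ Ω
    · exact Or.inl hb
    · exact Or.inr ⟨hb, a, ha, hab⟩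
  rcases h with h | h
  · exact ⟨Or.inl h, key x y h hxy, hxy⟩
  · exact ⟨key y x h (by rwa [edist_comm]), Or.inl h, hxy⟩

lemma ae_prod_of_ae {P : EuclideanSpace ℝ (Fin N) → Prop} (h : ∀ᵐ x, P x) :
    ∀ᵐ p : EuclideanSpace ℝ (Fin N) × EuclideanSpace ℝ (Fin N) ∂(volume.prod volume),
      P p.1 ∧ P p.2 :=
  (Measure.quasiMeasurePreserving_fst.ae h).and (Measure.quasiMeasurePreserving_snd.ae h)

lemma ae_interaction_of_ae (hΩ : IsOpen Ω) {P : EuclideanSpace ℝ (Fin N) → Prop}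
    (h : ∀ᵐ x ∂volume.restrict (domain Ω δ), P x) :
    ∀ᵐ p ∂(volume.prod volume).restrict (interaction Ω δ), P p.1 ∧ P p.2 := by
  rw [ae_restrict_iff' (measurableSet_domain hΩ)] at h
  rw [ae_restrict_iff' (measurableSet_interaction hΩ)]
  filter_upwards [ae_prod_of_ae h] with p hp hpi
  exact ⟨hp.1 hpi.1, hp.2 hpi.2.1⟩

lemma integrand_congr_ae (hΩ : IsOpen Ω) {u u' v v' : EuclideanSpace ℝ (Fin N) → ℝ}
    (hu : u =ᵐ[volume.restrict (domain Ω δ)] u') (hv : v =ᵐ[volume.restrict (domain Ω δ)] v') :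
    integrand s u v =ᵐ[(volume.prod volume).restrict (interaction Ω δ)] integrand s u' v' := by
  filter_upwards [ae_interaction_of_ae hΩ hu, ae_interaction_of_ae hΩ hv] with p h1 h2
  simp only [integrand, h1.1, h1.2, h2.1, h2.2]

lemma form_congr_ae (hΩ : IsOpen Ω) {u u' v v' : EuclideanSpace ℝ (Fin N) → ℝ}
    (hu : u =ᵐ[volume.restrict (domain Ω δ)] u') (hv : v =ᵐ[volume.restrict (domain Ω δ)] v') :
    form s Ω δ u v = form s Ω δ u' v' :=
  integral_congr_ae (integrand_congr_ae hΩ hu hv)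

lemma MemEnergySpace.congr_ae (hΩ : IsOpen Ω) {u u' : EuclideanSpace ℝ (Fin N) → ℝ}
    (hu : MemEnergySpace s Ω δ u) (h : u =ᵐ[volume.restrict (domain Ω δ)] u') :
    MemEnergySpace s Ω δ u' := by
  refine ⟨hu.memLp.ae_eq h, ?_, hu.finite_energy.congr (integrand_congr_ae hΩ h h)⟩
  have h' := h
  rw [EventuallyEq, ae_restrict_iff' (measurableSet_domain hΩ)] at h'
  filter_upwards [hu.eq_zero, h'] with y h1 h2 hy
  rw [← h2 (Or.inr hy), h1 hy]

lemma MemEnergySpace.indicator_ae_eq (hΩ : IsOpen Ω) {u : EuclideanSpace ℝ (Fin N) → ℝ}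
    (hu : MemEnergySpace s Ω δ u) : u =ᵐ[volume.restrict (domain Ω δ)] Ω.indicator u := by
  rw [EventuallyEq, ae_restrict_iff' (measurableSet_domain hΩ)]
  filter_upwards [hu.eq_zero] with y h1 hy
  by_cases hyΩ : y ∈ Ω
  · rw [indicator_of_mem hyΩ]
  · rw [indicator_of_notMem hyΩ, h1 (hy.resolve_left hyΩ)]

lemma indicator_congr_ae (hΩ : IsOpen Ω) {f g : EuclideanSpace ℝ (Fin N) → ℝ}
    (h : f =ᵐ[volume.restrict Ω] g) : Ω.indicator f =ᵐ[volume] Ω.indicator g := by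
  rw [EventuallyEq, ae_restrict_iff' hΩ.measurableSet] at h
  filter_upwards [h] with x hx
  by_cases hxΩ : x ∈ Ω
  · rw [indicator_of_mem hxΩ, indicator_of_mem hxΩ, hx hxΩ]
  · rw [indicator_of_notMem hxΩ, indicator_of_notMem hxΩ]

/-- Membership in the energy space for the extension by zero of a function on `Ω`. -/
lemma memEnergySpace_indicator_iff (hΩ : IsOpen Ω) {f : EuclideanSpace ℝ (Fin N) → ℝ}
    (hf : MemLp f 2 (volume.restrict Ω)) :
    MemEnergySpace s Ω δ (Ω.indicator f) ↔
      IntegrableOn (integrand s (Ω.indicator f) (Ω.indicator f)) (interaction Ω δ)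
        (volume.prod volume) := by
  refine ⟨fun h => h.finite_energy, fun h => ⟨?_, Eventually.of_forall fun y hy => ?_, h⟩⟩
  · exact ((memLp_indicator_iff_restrict hΩ.measurableSet).2 hf).restrict _
  · exact indicator_of_notMem hy.1 _

lemma inner_eq_setIntegral (f g : Lp ℝ 2 (volume.restrict Ω)) :
    inner ℝ f g = ∫ x in Ω, f x * g x := by
  rw [L2.inner_def]
  exact integral_congr_ae (Eventually.of_forall fun x => by simp [mul_comm])

/-- Energy functions vanish a.e. on the nonlocal boundary, so each agrees a.e. on Ω_δ with the zero
extension of its restriction. This moves the eigenvalue problem entirely into L²(Ω). -/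
lemma mem_eigenspace_iff (hΩ : IsOpen Ω) {μ : ℝ} {f : Lp ℝ 2 (volume.restrict Ω)} :
    f ∈ eigenspace s Ω δ μ ↔ MemEnergySpace s Ω δ (Ω.indicator f) ∧
      ∀ g : Lp ℝ 2 (volume.restrict Ω), MemEnergySpace s Ω δ (Ω.indicator g) →
        normConst N s / 2 * form s Ω δ (Ω.indicator f) (Ω.indicator g) = μ * inner ℝ f g := by
  constructor
  · rintro ⟨u, ⟨hu, huv⟩, hfu⟩
    have h1 : u =ᵐ[volume.restrict (domain Ω δ)] Ω.indicator f :=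
      (hu.indicator_ae_eq hΩ).trans (ae_restrict_of_ae (indicator_congr_ae hΩ hfu.symm))
    refine ⟨hu.congr_ae hΩ h1, fun g hg => ?_⟩
    rw [form_congr_ae hΩ h1.symm (EventuallyEq.refl _ _), huv _ hg, inner_eq_setIntegral]
    congr 1
    refine integral_congr_ae ?_
    filter_upwards [hfu, ae_restrict_mem hΩ.measurableSet] with x hx hxΩ
    rw [hx, indicator_of_mem hxΩ]
  · rintro ⟨hf, hfg⟩
    refine ⟨Ω.indicator f, ⟨hf, fun v hv => ?_⟩, (indicator_ae_eq_restrict hΩ.measurableSet).symm⟩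
    have h1 : v =ᵐ[volume.restrict (domain Ω δ)] Ω.indicator (hv.memLp_Ω.toLp v) :=
      (hv.indicator_ae_eq hΩ).trans
        (ae_restrict_of_ae (indicator_congr_ae hΩ hv.memLp_Ω.coeFn_toLp.symm))
    have h2 := hfg (hv.memLp_Ω.toLp v) (hv.congr_ae hΩ h1)
    rw [form_congr_ae hΩ (EventuallyEq.refl _ _) h1, h2, inner_eq_setIntegral]
    congr 1
    refine integral_congr_ae ?_
    filter_upwards [hv.memLp_Ω.coeFn_toLp, ae_restrict_mem hΩ.measurableSet] with x hx hxΩ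
    rw [hx, indicator_of_mem hxΩ]

/-- The weighted difference quotient `(u(x) - u(y)) / |x - y|^((N + 2s) / 2)`. -/
noncomputable def diffQuot (s : ℝ) (u : EuclideanSpace ℝ (Fin N) → ℝ)
    (p : EuclideanSpace ℝ (Fin N) × EuclideanSpace ℝ (Fin N)) : ℝ :=
  (u p.1 - u p.2) / ‖p.1 - p.2‖ ^ (((N : ℝ) + 2 * s) / 2)

lemma integrand_eq_diffQuot_mul (u v : EuclideanSpace ℝ (Fin N) → ℝ)
    (p : EuclideanSpace ℝ (Fin N) × EuclideanSpace ℝ (Fin N)) :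
    integrand s u v p = diffQuot s u p * diffQuot s v p := by
  have h : ‖p.1 - p.2‖ ^ ((N : ℝ) + 2 * s) =
      ‖p.1 - p.2‖ ^ (((N : ℝ) + 2 * s) / 2) * ‖p.1 - p.2‖ ^ (((N : ℝ) + 2 * s) / 2) := by
    rw [← sq, ← Real.rpow_mul_natCast (norm_nonneg _)]
    congr 1
    push_cast
    ring
  rw [integrand, h, diffQuot, diffQuot, div_mul_div_comm]

lemma integrand_self_nonneg (u : EuclideanSpace ℝ (Fin N) → ℝ)
    (p : EuclideanSpace ℝ (Fin N) × EuclideanSpace ℝ (Fin N)) : 0 ≤ integrand s u u p := by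
  rw [integrand_eq_diffQuot_mul]
  exact mul_self_nonneg _

lemma form_self_nonneg (u : EuclideanSpace ℝ (Fin N) → ℝ) : 0 ≤ form s Ω δ u u :=
  integral_nonneg fun _ => integrand_self_nonneg _ _

lemma form_comm (u v : EuclideanSpace ℝ (Fin N) → ℝ) : form s Ω δ u v = form s Ω δ v u := by
  unfold form
  simp only [integrand_eq_diffQuot_mul, mul_comm]

lemma diffQuot_congr_ae {u v : EuclideanSpace ℝ (Fin N) → ℝ} (h : u =ᵐ[volume] v) :
    diffQuot s u =ᵐ[volume.prod volume] diffQuot s v := by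
  filter_upwards [ae_prod_of_ae h] with p hp
  simp only [diffQuot, hp.1, hp.2]

lemma MemEnergySpace.memLp_diffQuot {u : EuclideanSpace ℝ (Fin N) → ℝ}
    (hu : MemEnergySpace s Ω δ u) :
    MemLp (diffQuot s u) 2 ((volume.prod volume).restrict (interaction Ω δ)) := by
  have hk : Measurable (fun p : EuclideanSpace ℝ (Fin N) × EuclideanSpace ℝ (Fin N) =>
      (‖p.1 - p.2‖ ^ (((N : ℝ) + 2 * s) / 2))⁻¹) := by fun_prop
  have hm : AEStronglyMeasurable (diffQuot s u)
      ((volume.prod volume).restrict (interaction Ω δ)) :=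
    hu.aesm_diff.mul hk.aestronglyMeasurable
  rw [memLp_two_iff_integrable_sq hm]
  refine hu.finite_energy.congr (Eventually.of_forall fun p => ?_)
  simp only [integrand_eq_diffQuot_mul, sq]

lemma indicator_add_ae (hΩ : IsOpen Ω) (f g : Lp ℝ 2 (volume.restrict Ω)) :
    Ω.indicator (f + g : Lp ℝ 2 (volume.restrict Ω)) =ᵐ[volume]
      fun x => Ω.indicator f x + Ω.indicator g x := by
  filter_upwards [indicator_congr_ae hΩ (Lp.coeFn_add f g)] with x hx
  rw [hx, indicator_add']
  rfl

lemma indicator_smul_ae (hΩ : IsOpen Ω) (c : ℝ) (f : Lp ℝ 2 (volume.restrict Ω)) :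
    Ω.indicator (c • f : Lp ℝ 2 (volume.restrict Ω)) =ᵐ[volume]
      fun x => c * Ω.indicator f x := by
  filter_upwards [indicator_congr_ae hΩ (Lp.coeFn_smul c f)] with x hx
  rw [hx]
  by_cases hxΩ : x ∈ Ω
  · simp [hxΩ]
  · simp [hxΩ]

variable (s Ω δ) in
/-- The energy space, realized as the graph of the difference quotient operator between `L²(Ω)` and
`L²` of the interacting pairs. -/
noncomputable def energyGraph (hΩ : IsOpen Ω) : Submodule ℝ (WithLp 2 (Lp ℝ 2 (volume.restrict Ω) ×
    Lp ℝ 2 ((volume.prod volume).restrict (interaction Ω δ)))) where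
  carrier := {w | w.snd =ᵐ[(volume.prod volume).restrict (interaction Ω δ)]
    diffQuot s (Ω.indicator w.fst)}
  zero_mem' := by
    have h0 : Ω.indicator (0 : Lp ℝ 2 (volume.restrict Ω)) =ᵐ[volume] fun _ => (0 : ℝ) :=
      (indicator_congr_ae hΩ (Lp.coeFn_zero _ _ _)).trans (by rw [indicator_zero']; rfl)
    have h1 : diffQuot s (Ω.indicator (0 : Lp ℝ 2 (volume.restrict Ω))) =ᵐ[(volume.prod
        volume).restrict (interaction Ω δ)] diffQuot s fun _ => 0 :=
      ae_restrict_of_ae (diffQuot_congr_ae h0)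
    refine (Lp.coeFn_zero _ _ _).trans (EventuallyEq.trans ?_ h1.symm)
    exact Eventually.of_forall fun p => by simp [diffQuot]
  add_mem' := by
    intro w w' hw hw'
    have h1 : diffQuot s (Ω.indicator (w.fst + w'.fst : Lp ℝ 2 (volume.restrict Ω))) =ᵐ[
        (volume.prod volume).restrict (interaction Ω δ)] diffQuot s fun x =>
          Ω.indicator w.fst x + Ω.indicator w'.fst x :=
      ae_restrict_of_ae (diffQuot_congr_ae (indicator_add_ae hΩ _ _))
    refine (Lp.coeFn_add _ _).trans (EventuallyEq.symm (EventuallyEq.trans h1 ?_))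
    filter_upwards [hw, hw'] with p hp hp'
    rw [Pi.add_apply]
    refine Eq.trans ?_ (congrArg₂ (· + ·) hp hp').symm
    simp only [diffQuot]
    ring
  smul_mem' := by
    intro c w hw
    have h1 : diffQuot s (Ω.indicator (c • w.fst : Lp ℝ 2 (volume.restrict Ω))) =ᵐ[
        (volume.prod volume).restrict (interaction Ω δ)] diffQuot s fun x =>
          c * Ω.indicator w.fst x :=
      ae_restrict_of_ae (diffQuot_congr_ae (indicator_smul_ae hΩ c _))
    refine (Lp.coeFn_smul _ _).trans (EventuallyEq.symm (EventuallyEq.trans h1 ?_))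
    filter_upwards [hw] with p hp
    rw [Pi.smul_apply, smul_eq_mul]
    refine Eq.trans ?_ (congrArg (c * ·) hp).symm
    simp only [diffQuot]
    ring

lemma mem_energyGraph_iff (hΩ : IsOpen Ω) {w : WithLp 2 (Lp ℝ 2 (volume.restrict Ω) ×
    Lp ℝ 2 ((volume.prod volume).restrict (interaction Ω δ)))} :
    w ∈ energyGraph s Ω δ hΩ ↔ w.snd =ᵐ[(volume.prod volume).restrict (interaction Ω δ)]
      diffQuot s (Ω.indicator w.fst) := Iff.rfl

/-- Along a common subsequence both components converge a.e., and the difference quotient passes to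
pointwise limits. -/
lemma isClosed_energyGraph (hΩ : IsOpen Ω) :
    IsClosed (energyGraph s Ω δ hΩ : Set (WithLp 2 (Lp ℝ 2 (volume.restrict Ω) ×
      Lp ℝ 2 ((volume.prod volume).restrict (interaction Ω δ))))) := by
  refine IsSeqClosed.isClosed fun w w₀ hw hlim => ?_
  have h1 : Tendsto (fun n => (w n).fst) atTop (𝓝 w₀.fst) :=
    ((WithLp.fstL 2 ℝ _ _).continuous.tendsto w₀).comp hlim
  have h2 : Tendsto (fun n => (w n).snd) atTop (𝓝 w₀.snd) :=
    ((WithLp.sndL 2 ℝ _ _).continuous.tendsto w₀).comp hlim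
  obtain ⟨a, ha, hae⟩ := (tendstoInMeasure_of_tendsto_Lp h1).exists_seq_tendsto_ae
  obtain ⟨b, hb, hbe⟩ := (tendstoInMeasure_of_tendsto_Lp
    (h2.comp ha.tendsto_atTop)).exists_seq_tendsto_ae
  rw [ae_restrict_iff' hΩ.measurableSet] at hae
  have hae' : ∀ᵐ x, Tendsto (fun i => Ω.indicator (w (a (b i))).fst x) atTop
      (𝓝 (Ω.indicator w₀.fst x)) := by
    filter_upwards [hae] with x hx
    by_cases hxΩ : x ∈ Ω
    · simp only [indicator_of_mem hxΩ]
      exact (hx hxΩ).comp hb.tendsto_atTop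
    · simp only [indicator_of_notMem hxΩ]
      exact tendsto_const_nhds
  have hall : ∀ᵐ p ∂(volume.prod volume).restrict (interaction Ω δ), ∀ i,
      (w (a (b i))).snd p = diffQuot s (Ω.indicator (w (a (b i))).fst) p :=
    ae_all_iff.2 fun i => hw _
  rw [SetLike.mem_coe, mem_energyGraph_iff]
  filter_upwards [hall, hbe, ae_restrict_of_ae (ae_prod_of_ae hae')] with p h3 h4 h5
  refine tendsto_nhds_unique h4 ?_
  simp only [Function.comp_apply, h3]
  exact (h5.1.sub h5.2).div_const _

variable (s Ω δ) in
/-- The energy space with the inner product `⟪f, g⟫ + ⟨f, g⟩_δ`. -/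
def EnergySpace (hΩ : IsOpen Ω) : Type := energyGraph s Ω δ hΩ

noncomputable instance instNormedAddCommGroupEnergySpace (hΩ : IsOpen Ω) :
    NormedAddCommGroup (EnergySpace s Ω δ hΩ) :=
  inferInstanceAs (NormedAddCommGroup (energyGraph s Ω δ hΩ))

noncomputable instance instInnerProductSpaceEnergySpace (hΩ : IsOpen Ω) :
    InnerProductSpace ℝ (EnergySpace s Ω δ hΩ) :=
  inferInstanceAs (InnerProductSpace ℝ (energyGraph s Ω δ hΩ))

instance instCompleteSpaceEnergySpace (hΩ : IsOpen Ω) : CompleteSpace (EnergySpace s Ω δ hΩ) :=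
  (isClosed_energyGraph hΩ).completeSpace_coe

variable (s Ω δ) in
/-- The embedding of the energy space into `L²(Ω)`. -/
noncomputable def energyEmbedding (hΩ : IsOpen Ω) :
    EnergySpace s Ω δ hΩ →L[ℝ] Lp ℝ 2 (volume.restrict Ω) :=
  (WithLp.fstL 2 ℝ _ _) ∘L (energyGraph s Ω δ hΩ).subtypeL

lemma exists_memLp_energySpace (hΩ : IsOpen Ω) (w : EnergySpace s Ω δ hΩ) :
    ∃ g : Lp ℝ 2 ((volume.prod volume).restrict (interaction Ω δ)),
      g =ᵐ[(volume.prod volume).restrict (interaction Ω δ)]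
        diffQuot s (Ω.indicator (energyEmbedding s Ω δ hΩ w)) :=
  ⟨_, w.2⟩

lemma memEnergySpace_energyEmbedding (hΩ : IsOpen Ω) (w : EnergySpace s Ω δ hΩ) :
    MemEnergySpace s Ω δ (Ω.indicator (energyEmbedding s Ω δ hΩ w)) := by
  obtain ⟨g, hg⟩ := exists_memLp_energySpace hΩ w
  generalize energyEmbedding s Ω δ hΩ w = f at hg
  refine (memEnergySpace_indicator_iff hΩ (Lp.memLp f)).2 ?_
  refine (Lp.memLp g).integrable_sq.congr ?_
  filter_upwards [hg] with p hp
  rw [integrand_eq_diffQuot_mul, hp, sq]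

lemma exists_energyEmbedding_eq (hΩ : IsOpen Ω) {f : Lp ℝ 2 (volume.restrict Ω)}
    (hf : MemEnergySpace s Ω δ (Ω.indicator f)) : ∃ w, energyEmbedding s Ω δ hΩ w = f :=
  ⟨⟨WithLp.toLp 2 (f, hf.memLp_diffQuot.toLp _),
    (mem_energyGraph_iff hΩ).2 hf.memLp_diffQuot.coeFn_toLp⟩, rfl⟩

lemma inner_eq_form_of_ae_eq {u u' : EuclideanSpace ℝ (Fin N) → ℝ}
    {g g' : Lp ℝ 2 ((volume.prod volume).restrict (interaction Ω δ))}
    (hg : g =ᵐ[(volume.prod volume).restrict (interaction Ω δ)] diffQuot s u)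
    (hg' : g' =ᵐ[(volume.prod volume).restrict (interaction Ω δ)] diffQuot s u') :
    inner ℝ g g' = form s Ω δ u u' := by
  rw [L2.inner_def]
  refine integral_congr_ae ?_
  filter_upwards [hg, hg'] with p hp hp'
  rw [integrand_eq_diffQuot_mul, hp, hp']
  simp [mul_comm]

lemma inner_energySpace (hΩ : IsOpen Ω) (w w' : EnergySpace s Ω δ hΩ) :
    inner ℝ w w' = inner ℝ (energyEmbedding s Ω δ hΩ w) (energyEmbedding s Ω δ hΩ w') +
      form s Ω δ (Ω.indicator (energyEmbedding s Ω δ hΩ w))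
        (Ω.indicator (energyEmbedding s Ω δ hΩ w')) := by
  refine (Submodule.coe_inner (energyGraph s Ω δ hΩ) w w').trans ((WithLp.prod_inner_apply _ _).trans ?_)
  exact congrArg _ (inner_eq_form_of_ae_eq w.2 w'.2)

end EnergySpace

/-! ### The tail of the kernel and its integral. -/

section Kernel

variable {N : ℕ} {s : ℝ}

/-- The kernel `|h|^(-N-2s)` cut off at distances less than `r`. -/
noncomputable def tailKernel (N : ℕ) (s r : ℝ) : EuclideanSpace ℝ (Fin N) → ℝ :=
  {h | r ≤ ‖h‖}.indicator fun h => (‖h‖ ^ ((N : ℝ) + 2 * s))⁻¹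

lemma tailKernel_nonneg (r : ℝ) (h : EuclideanSpace ℝ (Fin N)) : 0 ≤ tailKernel N s r h :=
  indicator_nonneg (fun _ _ => by positivity) h

lemma tailKernel_neg (r : ℝ) (h : EuclideanSpace ℝ (Fin N)) :
    tailKernel N s r (-h) = tailKernel N s r h := by
  simp [tailKernel, indicator]

lemma measurable_tailKernel (r : ℝ) : Measurable (tailKernel N s r) :=
  Measurable.indicator (by fun_prop) (measurableSet_le measurable_const measurable_norm)

lemma integrable_tailKernel (hs : 0 < s) {r : ℝ} (hr : 0 < r) :
    Integrable (tailKernel N s r) := by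
  -- For `‖h‖ ≥ r` one has `1 + ‖h‖ ≤ (1 + 1/r) ‖h‖`, which explains the constant in the domination.
  have hint : Integrable (fun h : EuclideanSpace ℝ (Fin N) => (1 + ‖h‖) ^ (-((N : ℝ) + 2 * s))) :=
    integrable_one_add_norm (by rw [finrank_euclideanSpace_fin]; linarith)
  refine (hint.const_mul ((1 + 1 / r) ^ ((N : ℝ) + 2 * s))).mono'
    (measurable_tailKernel r).aestronglyMeasurable (Eventually.of_forall fun h => ?_)
  rw [Real.norm_of_nonneg (tailKernel_nonneg r h)]
  have ha : 0 ≤ (N : ℝ) + 2 * s := by positivity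
  by_cases hh : r ≤ ‖h‖
  · have hpos : 0 < ‖h‖ := hr.trans_le hh
    rw [tailKernel, indicator_of_mem (by exact hh), Real.rpow_neg (by positivity),
      ← div_eq_mul_inv, ← Real.div_rpow (by positivity) (by positivity),
      ← Real.inv_rpow hpos.le]
    refine Real.rpow_le_rpow (by positivity) ?_ ha
    rw [le_div_iff₀ (by positivity), inv_mul_eq_div, add_div, div_self hpos.ne']
    have := one_div_le_one_div_of_le hr hh
    linarith
  · rw [tailKernel, indicator_of_notMem (by exact hh)]
    positivity

lemma tendsto_integral_tailKernel (hs : 0 < s) :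
    Tendsto (fun r => ∫ h, tailKernel N s r h) atTop (𝓝 0) := by
  rw [← integral_zero (EuclideanSpace ℝ (Fin N)) ℝ]
  refine tendsto_integral_filter_of_dominated_convergence (tailKernel N s 1)
    (Eventually.of_forall fun r => (measurable_tailKernel r).aestronglyMeasurable) ?_
    (integrable_tailKernel hs one_pos) (Eventually.of_forall fun h => ?_)
  · filter_upwards [eventually_ge_atTop 1] with r hr
    refine Eventually.of_forall fun h => ?_
    rw [Real.norm_of_nonneg (tailKernel_nonneg r h)]
    exact indicator_le_indicator_of_subset (fun h (hh : r ≤ ‖h‖) => hr.trans hh)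
      (fun _ => by positivity) h
  · refine tendsto_const_nhds.congr' ?_
    filter_upwards [eventually_gt_atTop ‖h‖] with r hr
    rw [tailKernel, indicator_of_notMem (by simpa using hr)]

variable {f k : EuclideanSpace ℝ (Fin N) → ℝ}

/-- Each of the two summands is a convolution integrand, with integral `(∫ f)(∫ k)` by Fubini and
translation invariance. Evenness lets the two variables be swapped in the integrability proof. -/
lemma integrable_add_mul_kernel (hf : Integrable f) (hk : Integrable k) (hke : ∀ h, k (-h) = k h) :
    Integrable (fun p : EuclideanSpace ℝ (Fin N) × EuclideanSpace ℝ (Fin N) =>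
      (f p.1 + f p.2) * k (p.1 - p.2)) (volume.prod volume) ∧
    ∫ p, (f p.1 + f p.2) * k (p.1 - p.2)
      ∂((volume : Measure (EuclideanSpace ℝ (Fin N))).prod volume) =
        2 * ((∫ x, f x) * ∫ h, k h) := by
  have h1 : Integrable (fun p : EuclideanSpace ℝ (Fin N) × EuclideanSpace ℝ (Fin N) =>
      f p.2 * k (p.1 - p.2)) (volume.prod volume) :=
    hf.convolution_integrand (ContinuousLinearMap.mul ℝ ℝ) hk
  have h2 : Integrable (fun p : EuclideanSpace ℝ (Fin N) × EuclideanSpace ℝ (Fin N) =>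
      f p.1 * k (p.1 - p.2)) (volume.prod volume) := by
    refine h1.swap.congr (Eventually.of_forall fun p => ?_)
    simp only [Function.comp_apply, Prod.fst_swap, Prod.snd_swap]
    rw [← hke, neg_sub]
  have e2 : ∫ p, f p.1 * k (p.1 - p.2)
      ∂((volume : Measure (EuclideanSpace ℝ (Fin N))).prod volume) =
        (∫ x, f x) * ∫ h, k h := by
    rw [integral_prod _ h2]
    simp only [integral_const_mul]
    rw [← integral_mul_const]
    refine integral_congr_ae (Eventually.of_forall fun x => ?_)
    simp only [integral_sub_left_eq_self k]
  have e1 : ∫ p, f p.2 * k (p.1 - p.2)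
      ∂((volume : Measure (EuclideanSpace ℝ (Fin N))).prod volume) =
        (∫ x, f x) * ∫ h, k h := by
    rw [integral_prod_symm _ h1]
    simp only [integral_const_mul]
    rw [← integral_mul_const]
    refine integral_congr_ae (Eventually.of_forall fun x => ?_)
    simp only [integral_sub_right_eq_self k]
  simp only [add_mul]
  refine ⟨h2.add h1, ?_⟩
  rw [integral_add h2 h1, e1, e2]
  ring

end Kernel

/-! ### Test functions have finite energy and are dense. -/

section Density

variable {N : ℕ} {s : ℝ} {Ω : Set (EuclideanSpace ℝ (Fin N))} {δ : ENNReal}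

open Metric in
lemma integrable_nearKernel (hN : 0 < N) (hs : s < 1) :
    Integrable ((ball (0 : EuclideanSpace ℝ (Fin N)) 1).indicator
      fun h => ‖h‖ ^ (-((N : ℝ) + 2 * s - 2))) := by
  rw [integrable_indicator_iff measurableSet_ball]
  refine integrableOn_ball_of_norm_le_rpow (C := 1) (α := (N : ℝ) + 2 * s - 2) ?_ ?_
    (Eventually.of_forall fun x => ?_) ?_
  · rw [finrank_euclideanSpace_fin]
    exact hN
  · rw [finrank_euclideanSpace_fin]
    linarith
  · rw [one_mul, Real.norm_of_nonneg (by positivity)]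
  · exact Measurable.aestronglyMeasurable (by fun_prop)

/-- The Lipschitz bound lowers the singularity at the diagonal to the exponent `N + 2s - 2 < N`;
boundedness of `g` handles distant pairs. Only pairs meeting the bounded set Ω contribute, so
`integrable_add_mul_kernel` with the indicator of Ω gives a dominating function. -/
lemma memEnergySpace_of_contDiff (hN : 0 < N) (hs : s ∈ Ioo (0 : ℝ) 1) (hΩ : IsOpen Ω)
    (hΩb : Bornology.IsBounded Ω) {g : EuclideanSpace ℝ (Fin N) → ℝ} (hg : ContDiff ℝ 1 g)
    (hgc : HasCompactSupport g) (hgs : tsupport g ⊆ Ω) : MemEnergySpace s Ω δ g := by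
  have hg0 : ∀ y, y ∉ Ω → g y = 0 := fun y hy => image_eq_zero_of_notMem_tsupport fun h => hy (hgs h)
  refine ⟨(hg.continuous.memLp_of_hasCompactSupport hgc), Eventually.of_forall fun y hy =>
    hg0 y hy.1, Integrable.integrableOn ?_⟩
  obtain ⟨L, hL⟩ := hg.lipschitzWith_of_hasCompactSupport hgc one_ne_zero
  obtain ⟨M, hM⟩ := hgc.exists_bound_of_continuous hg.continuous
  set k : EuclideanSpace ℝ (Fin N) → ℝ := fun h => (L : ℝ) ^ 2 * (Metric.ball 0 1).indicator
    (fun h => ‖h‖ ^ (-((N : ℝ) + 2 * s - 2))) h + (2 * M) ^ 2 * tailKernel N s 1 h with hk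
  have hki : Integrable k := ((integrable_nearKernel hN hs.2).const_mul _).add
    ((integrable_tailKernel hs.1 one_pos).const_mul _)
  have hke : ∀ h, k (-h) = k h := fun h => by
    simp [hk, tailKernel_neg, indicator]
  have hfi : Integrable (Ω.indicator fun _ => (1 : ℝ)) := by
    rw [integrable_indicator_iff hΩ.measurableSet]
    exact integrableOn_const hΩb.measure_lt_top.ne
  have hk0 : ∀ h, 0 ≤ k h := fun h => by
    have h1 := indicator_nonneg (s := Metric.ball (0 : EuclideanSpace ℝ (Fin N)) 1)
      (f := fun h => ‖h‖ ^ (-((N : ℝ) + 2 * s - 2))) (fun _ _ => by positivity) h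
    have h2 := tailKernel_nonneg (s := s) 1 h
    positivity
  have hbound : ∀ x y : EuclideanSpace ℝ (Fin N), integrand s g g (x, y) ≤ k (x - y) := by
    intro x y
    by_cases h0 : x = y
    · subst h0
      simpa [integrand] using hk0 (x - x)
    simp only [integrand, hk, ← sq]
    have hpos : 0 < ‖x - y‖ := norm_pos_iff.2 (sub_ne_zero.2 h0)
    by_cases h1 : ‖x - y‖ < 1
    · have hsq : (g x - g y) ^ 2 ≤ (L * ‖x - y‖) ^ 2 := by
        refine sq_le_sq' ?_ ?_ <;> have h2 := hL.dist_le_mul x y <;>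
          rw [Real.dist_eq, dist_eq_norm] at h2 <;> have h3 := abs_le.1 h2 <;> linarith
      rw [indicator_of_mem (by simpa using h1), tailKernel, indicator_of_notMem (by simpa using h1),
        mul_zero, add_zero, div_le_iff₀ (by positivity), mul_assoc, ← Real.rpow_add hpos]
      refine hsq.trans_eq ?_
      rw [mul_pow, ← Real.rpow_natCast ‖x - y‖ 2]
      congr 2
      push_cast
      ring
    · have hsq : (g x - g y) ^ 2 ≤ (2 * M) ^ 2 := by
        have h2 := abs_le.1 (hM x)
        have h3 := abs_le.1 (hM y)
        refine sq_le_sq' ?_ ?_ <;> linarith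
      rw [indicator_of_notMem (by simpa using h1), tailKernel,
        indicator_of_mem (by simpa using h1), mul_zero, zero_add, div_eq_mul_inv]
      gcongr
  refine (integrable_add_mul_kernel hfi hki hke).1.mono' ?_ (Eventually.of_forall fun p => ?_)
  · have hgm := hg.continuous.measurable
    refine Measurable.aestronglyMeasurable ?_
    unfold integrand
    fun_prop
  · obtain ⟨x, y⟩ := p
    rw [Real.norm_of_nonneg (integrand_self_nonneg _ _)]
    have h1 : ∀ z, 0 ≤ Ω.indicator (fun _ => (1 : ℝ)) z := indicator_nonneg fun _ _ => zero_le_one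
    by_cases h : x ∈ Ω ∨ y ∈ Ω
    · have h2 : 1 ≤ Ω.indicator (fun _ => (1 : ℝ)) x + Ω.indicator (fun _ => (1 : ℝ)) y := by
        rcases h with h | h
        · rw [indicator_of_mem h]
          linarith [h1 y]
        · rw [indicator_of_mem h (fun _ => (1 : ℝ))]
          linarith [h1 x]
      exact (hbound x y).trans (le_mul_of_one_le_left (hk0 _) h2)
    · push Not at h
      simp only [integrand, hg0 x h.1, hg0 y h.2, indicator_of_notMem h.1, indicator_of_notMem h.2]
      simp

/-- Smooth functions with compact support in Ω belong to the energy space, so the fundamental lemma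
of the calculus of variations applies. -/
lemma eq_zero_of_forall_inner_energyEmbedding (hN : 0 < N) (hs : s ∈ Ioo (0 : ℝ) 1)
    (hΩ : IsOpen Ω) (hΩb : Bornology.IsBounded Ω) (e : Lp ℝ 2 (volume.restrict Ω))
    (he : ∀ w, inner ℝ e (energyEmbedding s Ω δ hΩ w) = 0) : e = 0 := by
  have hfin : IsFiniteMeasure ((volume : Measure (EuclideanSpace ℝ (Fin N))).restrict Ω) :=
    isFiniteMeasure_restrict.2 hΩb.measure_lt_top.ne
  have hint : IntegrableOn e Ω := (Lp.memLp e).integrable (by norm_num)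
  have h0 : ∀ᵐ x, x ∈ Ω → e x = 0 := by
    refine hΩ.ae_eq_zero_of_integral_contDiff_smul_eq_zero hint.locallyIntegrableOn
      fun g hg hgc hgs => ?_
    have hg0 : ∀ y, y ∉ Ω → g y = 0 :=
      fun y hy => image_eq_zero_of_notMem_tsupport fun h => hy (hgs h)
    have hmem : MemEnergySpace s Ω δ g :=
      memEnergySpace_of_contDiff hN hs hΩ hΩb (hg.of_le (by norm_cast)) hgc hgs
    have hae : g =ᵐ[volume.restrict (domain Ω δ)] Ω.indicator (hmem.memLp_Ω.toLp g) :=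
      (hmem.indicator_ae_eq hΩ).trans
        (ae_restrict_of_ae (indicator_congr_ae hΩ hmem.memLp_Ω.coeFn_toLp.symm))
    obtain ⟨w, hw⟩ := exists_energyEmbedding_eq hΩ (hmem.congr_ae hΩ hae)
    have h1 := he w
    rw [hw, inner_eq_setIntegral] at h1
    rw [← setIntegral_eq_integral_of_forall_compl_eq_zero (s := Ω)
      (fun x hx => by rw [hg0 x hx, zero_smul]), ← h1]
    refine integral_congr_ae ?_
    filter_upwards [hmem.memLp_Ω.coeFn_toLp] with x hx
    rw [hx, smul_eq_mul, mul_comm]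
  refine (Lp.eq_zero_iff_ae_eq_zero).2 ?_
  rwa [EventuallyEq, ae_restrict_iff' hΩ.measurableSet]

end Density

/-! ### Cubic grids. -/

section Grid

variable {N : ℕ}

/-- The index of the cell of the grid of mesh size `h` which contains `x`. -/
noncomputable def cellIndex (h : ℝ) (x : EuclideanSpace ℝ (Fin N)) : Fin N → ℤ :=
  fun i => ⌊x i / h⌋

/-- The half-open cubes of the grid of mesh size `h`. -/
def cell (h : ℝ) (z : Fin N → ℤ) : Set (EuclideanSpace ℝ (Fin N)) :=
  {x | cellIndex h x = z}

lemma measurableSet_cell (h : ℝ) (z : Fin N → ℤ) : MeasurableSet (cell h z) := by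
  have hm : Measurable (cellIndex (N := N) h) := by
    refine measurable_pi_lambda _ fun i => Measurable.floor ?_
    fun_prop
  exact hm (measurableSet_singleton z)

lemma volume_cell {h : ℝ} (hh : 0 < h) (z : Fin N → ℤ) :
    volume (cell h z) = ENNReal.ofReal (h ^ N) := by
  have h1 : cell h z = (WithLp.ofLp : EuclideanSpace ℝ (Fin N) → Fin N → ℝ) ⁻¹'
      (Set.pi univ fun i => Ico (z i * h) ((z i + 1) * h)) := by
    ext x
    simp only [cell, cellIndex, funext_iff, Int.floor_eq_iff, mem_preimage, Set.mem_pi, mem_univ,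
      true_imp_iff, mem_Ico, mem_ofPred_eq, le_div_iff₀ hh, div_lt_iff₀ hh]
  rw [h1, (PiLp.volume_preserving_ofLp (Fin N)).measure_preimage
    (MeasurableSet.univ_pi fun _ => measurableSet_Ico).nullMeasurableSet, volume_pi_pi]
  simp only [Real.volume_Ico, add_mul, one_mul, add_sub_cancel_left, Finset.prod_const,
    Finset.card_univ, Fintype.card_fin, ENNReal.ofReal_pow hh.le]

lemma norm_sub_le_of_cellIndex_eq {h : ℝ} (hh : 0 < h) {x y : EuclideanSpace ℝ (Fin N)}
    (hxy : cellIndex h x = cellIndex h y) : ‖x - y‖ ≤ √N * h := by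
  have h1 : ∀ i, ‖(x - y) i‖ ^ 2 ≤ h ^ 2 := by
    intro i
    have h2 := Int.abs_sub_lt_one_of_floor_eq_floor (congrFun hxy i)
    rw [← sub_div, abs_div, abs_of_pos hh, div_lt_one hh] at h2
    exact pow_le_pow_left₀ (norm_nonneg _) h2.le 2
  rw [EuclideanSpace.norm_eq]
  refine (Real.sqrt_le_sqrt (Finset.sum_le_card_nsmul _ _ _ fun i _ => h1 i)).trans_eq ?_
  rw [Finset.card_univ, Fintype.card_fin, nsmul_eq_mul, Real.sqrt_mul (Nat.cast_nonneg _),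
    Real.sqrt_sq hh.le]

lemma finite_image_cellIndex {h : ℝ} (hh : 0 < h) {Ω : Set (EuclideanSpace ℝ (Fin N))}
    (hΩb : Bornology.IsBounded Ω) : (cellIndex h '' Ω).Finite := by
  obtain ⟨R, hR⟩ := hΩb.exists_norm_le
  refine (Set.finite_Icc (fun _ : Fin N => ⌊-R / h⌋) fun _ => ⌊R / h⌋).subset ?_
  rintro _ ⟨x, hx, rfl⟩
  have h1 : ∀ i, |x i| ≤ R := fun i => (PiLp.norm_apply_le x i).trans (hR x hx)
  exact ⟨fun i => Int.floor_le_floor (div_le_div_of_nonneg_right (abs_le.1 (h1 i)).1 hh.le),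
    fun i => Int.floor_le_floor (div_le_div_of_nonneg_right (abs_le.1 (h1 i)).2 hh.le)⟩

end Grid

/-! ### Compactness of the embedding by averaging over cells. -/

section Compactness

/-- Cauchy–Schwarz against the constant 1, obtained by expanding the nonnegative integral of `(m g -
I)²`. -/
lemma sq_integral_le {α : Type*} [MeasurableSpace α] {ν : Measure α} [IsFiniteMeasure ν]
    (hν : 0 < ν.real univ) {g : α → ℝ} (hg : MemLp g 2 ν) :
    (∫ x, g x ∂ν) ^ 2 ≤ ν.real univ * ∫ x, g x ^ 2 ∂ν := by
  set m := ν.real univ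
  set I := ∫ x, g x ∂ν with hI
  have hg1 : Integrable g ν := hg.integrable (by norm_num)
  have hg2 := hg.integrable_sq
  have h1 : ∫ x, (m * g x - I) ^ 2 ∂ν = m * (m * ∫ x, g x ^ 2 ∂ν - I ^ 2) := by
    have h2 : ∀ x, (m * g x - I) ^ 2 = m ^ 2 * g x ^ 2 + (-(2 * m * I) * g x + I ^ 2) :=
      fun x => by ring
    simp only [h2]
    rw [integral_add (hg2.const_mul _) (by fun_prop),
      integral_add (hg1.const_mul _) (integrable_const _), integral_const_mul, integral_const_mul,
      integral_const, smul_eq_mul, ← hI]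
    ring
  have h3 : 0 ≤ m * (m * ∫ x, g x ^ 2 ∂ν - I ^ 2) := h1 ▸ integral_nonneg fun _ => sq_nonneg _
  linarith [nonneg_of_mul_nonneg_right h3 hν]

variable {N : ℕ} {s : ℝ} {Ω : Set (EuclideanSpace ℝ (Fin N))} {δ : ENNReal}

/-- The mean value of `u` over a cell. -/
noncomputable def cellMean (h : ℝ) (u : EuclideanSpace ℝ (Fin N) → ℝ) (z : Fin N → ℤ) : ℝ :=
  (h ^ N)⁻¹ * ∫ y in cell h z, u y

/-- The left side is the square of an average of `u x - u y` over the cell of `x`. Points of one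
cell are at most `√N h < δ` apart, so all these pairs interact and the kernel is bounded below
there. -/
lemma sq_sub_cellMean_le (hs : 0 < s) {h : ℝ} (hh : 0 < h) (hhδ : ENNReal.ofReal (√N * h) < δ)
    {u : EuclideanSpace ℝ (Fin N) → ℝ} (hu : MemLp u 2) {x : EuclideanSpace ℝ (Fin N)} (hx : x ∈ Ω)
    (hint : Integrable fun y => (interaction Ω δ).indicator (integrand s u u) (x, y)) :
    (u x - cellMean h u (cellIndex h x)) ^ 2 ≤ (√N * h) ^ ((N : ℝ) + 2 * s) / h ^ N *
      ∫ y, (interaction Ω δ).indicator (integrand s u u) (x, y) := by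
  set Q := cell h (cellIndex h x) with hQ
  have hQm : MeasurableSet Q := measurableSet_cell _ _
  have hvol : volume.real Q = h ^ N := by
    rw [measureReal_def, volume_cell hh, ENNReal.toReal_ofReal (by positivity)]
  have hfin : IsFiniteMeasure (volume.restrict Q) :=
    isFiniteMeasure_restrict.2 (by rw [volume_cell hh]; exact ENNReal.ofReal_ne_top)
  have hm : (volume.restrict Q).real univ = h ^ N := by
    rw [measureReal_restrict_apply_univ, hvol]
  have hhN : 0 < h ^ N := by positivity
  have huQ : MemLp u 2 (volume.restrict Q) := hu.restrict Q
  have hg : MemLp (fun y => u x - u y) 2 (volume.restrict Q) := (memLp_const (u x)).sub huQ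
  have h1 : ∫ y in Q, (u x - u y) = h ^ N * (u x - cellMean h u (cellIndex h x)) := by
    rw [integral_sub (integrable_const _) (huQ.integrable (by norm_num)), integral_const, hm,
      smul_eq_mul, mul_sub, cellMean, mul_inv_cancel_left₀ hhN.ne']
  have h2 := sq_integral_le (hm ▸ hhN) hg
  rw [h1, hm] at h2
  have hG0 : ∀ p, 0 ≤ (interaction Ω δ).indicator (integrand s u u) p :=
    indicator_nonneg fun p _ => integrand_self_nonneg u p
  set D := (√N * h) ^ ((N : ℝ) + 2 * s) with hD
  have hD0 : 0 ≤ D := by positivity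
  have h3 : ∫ y in Q, (u x - u y) ^ 2 ≤
      D * ∫ y, (interaction Ω δ).indicator (integrand s u u) (x, y) := by
    rw [← integral_const_mul]
    refine le_trans (integral_mono_of_nonneg (Eventually.of_forall fun _ => sq_nonneg _)
      (hint.const_mul D).integrableOn ?_) (setIntegral_le_integral (hint.const_mul D)
        (Eventually.of_forall fun y => mul_nonneg hD0 (hG0 _)))
    filter_upwards [ae_restrict_mem hQm] with y hy
    have hxy : ‖x - y‖ ≤ √N * h := norm_sub_le_of_cellIndex_eq hh (Eq.symm hy)
    have hmem : (x, y) ∈ interaction Ω δ := by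
      refine mem_interaction_of_mem (Or.inl hx) (lt_of_le_of_lt ?_ hhδ)
      rw [edist_dist, dist_eq_norm]
      exact ENNReal.ofReal_le_ofReal hxy
    rw [indicator_of_mem hmem]
    by_cases h0 : x = y
    · subst h0
      simp [integrand]
    have hpos : 0 < ‖x - y‖ := norm_pos_iff.2 (sub_ne_zero.2 h0)
    simp only [integrand, ← sq]
    rw [mul_div_assoc', le_div_iff₀ (by positivity), mul_comm]
    refine mul_le_mul_of_nonneg_right ?_ (sq_nonneg _)
    exact Real.rpow_le_rpow hpos.le hxy (by positivity)
  rw [div_mul_eq_mul_div, le_div_iff₀ hhN]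
  have h4 : h ^ N * (h ^ N * (u x - cellMean h u (cellIndex h x)) ^ 2) ≤
      h ^ N * (D * ∫ y, (interaction Ω δ).indicator (integrand s u u) (x, y)) := by
    calc _ = (h ^ N * (u x - cellMean h u (cellIndex h x))) ^ 2 := by ring
      _ ≤ _ := h2
      _ ≤ _ := mul_le_mul_of_nonneg_left h3 hhN.le
  linarith [le_of_mul_le_mul_left h4 hhN]

lemma setIntegral_sq_sub_cellMean_le (hs : 0 < s) (hΩ : IsOpen Ω) {h : ℝ} (hh : 0 < h)
    (hhδ : ENNReal.ofReal (√N * h) < δ) {u : EuclideanSpace ℝ (Fin N) → ℝ} (hu : MemLp u 2)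
    (huE : MemEnergySpace s Ω δ u) :
    ∫ x in Ω, (u x - cellMean h u (cellIndex h x)) ^ 2 ≤
      (√N * h) ^ ((N : ℝ) + 2 * s) / h ^ N * form s Ω δ u u := by
  have hG : Integrable ((interaction Ω δ).indicator (integrand s u u)) (volume.prod volume) :=
    (integrable_indicator_iff (measurableSet_interaction hΩ)).2 huE.finite_energy
  have hG0 : ∀ p, 0 ≤ (interaction Ω δ).indicator (integrand s u u) p :=
    indicator_nonneg fun p _ => integrand_self_nonneg u p
  have hC : 0 ≤ (√N * h) ^ ((N : ℝ) + 2 * s) / h ^ N := by positivity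
  rw [form, ← integral_indicator (measurableSet_interaction hΩ), integral_prod _ hG,
    ← integral_const_mul]
  have hi := hG.integral_prod_left.const_mul ((√N * h) ^ ((N : ℝ) + 2 * s) / h ^ N)
  refine le_trans (integral_mono_of_nonneg (Eventually.of_forall fun _ => sq_nonneg _)
    hi.integrableOn ?_) (setIntegral_le_integral hi
      (Eventually.of_forall fun x => mul_nonneg hC (integral_nonneg fun y => hG0 _)))
  filter_upwards [ae_restrict_mem hΩ.measurableSet, ae_restrict_of_ae hG.prod_right_ae] with x hx hi
  exact sq_sub_cellMean_le hs hh hhδ hu hx hi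

lemma exists_mesh (hs : 0 < s) (hδ : 0 < δ) {ε : ℝ} (hε : 0 < ε) :
    ∃ h : ℝ, 0 < h ∧ ENNReal.ofReal (√N * h) < δ ∧
      (√N * h) ^ ((N : ℝ) + 2 * s) / h ^ N ≤ ε := by
  have h1 : Tendsto (fun h : ℝ => ENNReal.ofReal (√N * h)) (𝓝[>] 0) (𝓝 0) := by
    have : Tendsto (fun h : ℝ => ENNReal.ofReal (√N * h)) (𝓝 0) (𝓝 (ENNReal.ofReal (√N * 0))) :=
      (ENNReal.continuous_ofReal.comp (continuous_const.mul continuous_id)).tendsto 0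
    rw [mul_zero, ENNReal.ofReal_zero] at this
    exact this.mono_left nhdsWithin_le_nhds
  -- For `h > 0` this is the error constant after cancelling `h ^ N`.
  have h2 : Tendsto (fun h : ℝ => √N ^ ((N : ℝ) + 2 * s) * h ^ (2 * s)) (𝓝[>] 0) (𝓝 0) := by
    have : Tendsto (fun h : ℝ => √N ^ ((N : ℝ) + 2 * s) * h ^ (2 * s)) (𝓝 0)
        (𝓝 (√N ^ ((N : ℝ) + 2 * s) * 0 ^ (2 * s))) :=
      (((Real.continuous_rpow_const (by positivity)).tendsto 0).const_mul _)
    rw [Real.zero_rpow (by positivity), mul_zero] at this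
    exact this.mono_left nhdsWithin_le_nhds
  obtain ⟨h, ⟨hh1, hh2⟩, hh⟩ := ((h1.eventually_lt_const hδ).and
    (h2.eventually_lt_const hε)).and self_mem_nhdsWithin |>.exists
  have hh : 0 < h := hh
  refine ⟨h, hh, hh1, le_trans (le_of_eq ?_) hh2.le⟩
  rw [Real.mul_rpow (Real.sqrt_nonneg _) hh.le, Real.rpow_add hh, Real.rpow_natCast]
  field_simp

variable (Ω) in
/-- The subspace of `L²(Ω)` of the functions which are constant on the cells of a grid. -/
noncomputable def cellwiseConstant (h : ℝ) : Submodule ℝ (Lp ℝ 2 (volume.restrict Ω)) :=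
  Submodule.span ℝ {b | ∃ z ∈ cellIndex h '' Ω,
    b =ᵐ[volume.restrict Ω] (cell h z).indicator fun _ => (1 : ℝ)}

lemma finiteDimensional_cellwiseConstant (hΩb : Bornology.IsBounded Ω) {h : ℝ} (hh : 0 < h) :
    FiniteDimensional ℝ (cellwiseConstant Ω h) := by
  refine FiniteDimensional.span_of_finite ℝ ?_
  have : ∀ z, {b : Lp ℝ 2 (volume.restrict Ω) | b =ᵐ[volume.restrict Ω]
      (cell h z).indicator fun _ => (1 : ℝ)}.Subsingleton :=
    fun z b hb b' hb' =>
      Lp.ext (EventuallyEq.trans (mem_ofPred.1 hb) (EventuallyEq.symm (mem_ofPred.1 hb')))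
  refine ((finite_image_cellIndex hh hΩb).biUnion fun z _ => (this z).finite).subset ?_
  rintro b ⟨z, hz, hb⟩
  exact mem_biUnion hz hb

lemma exists_mem_cellwiseConstant (hΩ : IsOpen Ω) (hΩb : Bornology.IsBounded Ω) {h : ℝ}
    (hh : 0 < h) (a : (Fin N → ℤ) → ℝ) :
    ∃ v ∈ cellwiseConstant Ω h, ∀ᵐ x ∂volume.restrict Ω, v x = a (cellIndex h x) := by
  have hfin : IsFiniteMeasure ((volume : Measure (EuclideanSpace ℝ (Fin N))).restrict Ω) :=
    isFiniteMeasure_restrict.2 hΩb.measure_lt_top.ne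
  set Z := (finite_image_cellIndex hh hΩb).toFinset with hZ
  have hb : ∀ z, ∃ b : Lp ℝ 2 (volume.restrict Ω),
      b =ᵐ[volume.restrict Ω] (cell h z).indicator fun _ => (1 : ℝ) := fun z =>
    ⟨indicatorConstLp 2 (measurableSet_cell h z) (measure_ne_top _ _) (1 : ℝ),
      indicatorConstLp_coeFn⟩
  choose b hb using hb
  refine ⟨∑ z ∈ Z, a z • b z, Submodule.sum_mem _ fun z hz => Submodule.smul_mem _ _
    (Submodule.subset_span ⟨z, (Set.Finite.mem_toFinset _).1 hz, hb z⟩), ?_⟩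
  have h1 : ∀ᵐ x ∂volume.restrict Ω, ∀ z, (a z • b z : Lp ℝ 2 (volume.restrict Ω)) x =
      a z * (cell h z).indicator (fun _ => 1) x := by
    refine ae_all_iff.2 fun z => ?_
    filter_upwards [Lp.coeFn_smul (a z) (b z), hb z] with x hx1 hx2
    rw [hx1, Pi.smul_apply, smul_eq_mul, hx2]
  filter_upwards [Lp.coeFn_finsetSum Z (fun z => a z • b z), h1,
    ae_restrict_mem hΩ.measurableSet] with x hx1 hx2 hxΩ
  rw [hx1, Finset.sum_apply, Finset.sum_congr rfl fun z _ => hx2 z,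
    Finset.sum_eq_single (cellIndex h x)]
  · rw [indicator_of_mem (by rfl), mul_one]
  · intro z _ hz
    rw [indicator_of_notMem (fun hh => hz hh.symm), mul_zero]
  · intro hx
    exact absurd ((Set.Finite.mem_toFinset _).2 (mem_image_of_mem _ hxΩ)) hx

lemma exists_norm_sub_sq_le (hs : 0 < s) (hΩ : IsOpen Ω) (hΩb : Bornology.IsBounded Ω) {h : ℝ}
    (hh : 0 < h) (hhδ : ENNReal.ofReal (√N * h) < δ) {f : Lp ℝ 2 (volume.restrict Ω)}
    (hf : MemEnergySpace s Ω δ (Ω.indicator f)) :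
    ∃ v ∈ cellwiseConstant Ω h, ‖f - v‖ ^ 2 ≤
      (√N * h) ^ ((N : ℝ) + 2 * s) / h ^ N * form s Ω δ (Ω.indicator f) (Ω.indicator f) := by
  obtain ⟨v, hv, hvae⟩ :=
    exists_mem_cellwiseConstant hΩ hΩb hh (cellMean h (Ω.indicator f))
  refine ⟨v, hv, le_trans (le_of_eq ?_) (setIntegral_sq_sub_cellMean_le hs hΩ hh hhδ
    ((memLp_indicator_iff_restrict hΩ.measurableSet).2 (Lp.memLp f)) hf)⟩
  rw [← real_inner_self_eq_norm_sq, inner_eq_setIntegral]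
  refine integral_congr_ae ?_
  filter_upwards [Lp.coeFn_sub f v, hvae, ae_restrict_mem hΩ.measurableSet] with x hx1 hx2 hxΩ
  rw [hx1, Pi.sub_apply, hx2, indicator_of_mem hxΩ, sq]

lemma form_energyEmbedding_le (hΩ : IsOpen Ω) (w : EnergySpace s Ω δ hΩ) :
    form s Ω δ (Ω.indicator (energyEmbedding s Ω δ hΩ w))
      (Ω.indicator (energyEmbedding s Ω δ hΩ w)) ≤ ‖w‖ ^ 2 := by
  rw [← real_inner_self_eq_norm_sq, inner_energySpace]
  exact le_add_of_nonneg_left real_inner_self_nonneg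

/-- The energy space is compactly embedded in `L²(Ω)`: elements are approximated by their means over
the cells of a grid. -/
lemma finiteRankApproximable_energyEmbedding (hs : 0 < s) (hΩ : IsOpen Ω)
    (hΩb : Bornology.IsBounded Ω) (hδ : 0 < δ) :
    FiniteRankApproximable (energyEmbedding s Ω δ hΩ) := by
  intro ε hε
  obtain ⟨h, hh, hhδ, hhε⟩ := exists_mesh (N := N) hs hδ (show 0 < ε ^ 2 by positivity)
  refine ⟨cellwiseConstant Ω h, finiteDimensional_cellwiseConstant hΩb hh, fun w => ?_⟩
  obtain ⟨v, hv, hle⟩ := exists_norm_sub_sq_le hs hΩ hΩb hh hhδ (memEnergySpace_energyEmbedding hΩ w)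
  refine ⟨v, hv, (pow_le_pow_iff_left₀ (norm_nonneg _) (by positivity) two_ne_zero).1 ?_⟩
  rw [mul_pow]
  exact hle.trans (mul_le_mul hhε (form_energyEmbedding_le hΩ w) (form_self_nonneg _)
    (by positivity))

end Compactness

/-! ### Discreteness and positivity of the spectrum at a fixed horizon. -/

section Spectrum

variable {N : ℕ} {s : ℝ} {Ω : Set (EuclideanSpace ℝ (Fin N))} {δ : ENNReal}

lemma normConst_pos (hs : s ∈ Ioo (0 : ℝ) 1) : 0 < normConst N s := by
  have h0 := hs.1
  have h1 := Real.Gamma_pos_of_pos (show 0 < (N : ℝ) / 2 + s by positivity)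
  have h2 := Real.Gamma_pos_of_pos (show 0 < 1 - s by linarith [hs.2])
  have h3 := Real.pi_pos
  unfold normConst
  positivity

/-- Zero energy forces `u x = u y` for almost every pair closer than `δ`; the shear `y = x + h`
turns this into periodicity under almost every small `h`. -/
lemma ae_eq_of_form_self_eq_zero (hΩ : IsOpen Ω) {u : EuclideanSpace ℝ (Fin N) → ℝ}
    (hu0 : ∀ x, x ∉ Ω → u x = 0) (hu : MemEnergySpace s Ω δ u) (h0 : form s Ω δ u u = 0) :
    ∀ᵐ h, ∀ᵐ x, edist x (x + h) < δ → u x = u (x + h) := by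
  have h1 := (integral_eq_zero_iff_of_nonneg (fun p => integrand_self_nonneg u p)
    hu.finite_energy).1 h0
  rw [EventuallyEq, ae_restrict_iff' (measurableSet_interaction hΩ)] at h1
  have h2 : ∀ᵐ p : EuclideanSpace ℝ (Fin N) × EuclideanSpace ℝ (Fin N) ∂(volume.prod volume),
      edist p.1 p.2 < δ → u p.1 = u p.2 := by
    filter_upwards [h1] with ⟨x, y⟩ hp hd
    by_cases hΩxy : x ∈ Ω ∨ y ∈ Ω
    · have h3 := hp (mem_interaction_of_mem hΩxy hd)
      by_cases hxy : x = y
      · rw [hxy]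
      · have hpos : 0 < ‖x - y‖ := norm_pos_iff.2 (sub_ne_zero.2 hxy)
        simp only [integrand, Pi.zero_apply, div_eq_zero_iff, mul_self_eq_zero] at h3
        exact sub_eq_zero.1 (h3.resolve_right (by positivity))
    · push Not at hΩxy
      simp only [hu0 x hΩxy.1, hu0 y hΩxy.2]
  have h3 := (measurePreserving_prod_add (volume : Measure (EuclideanSpace ℝ (Fin N)))
    volume).quasiMeasurePreserving.ae h2
  exact Measure.ae_ae_of_ae_prod
    ((Measure.measurePreserving_swap (μ := (volume : Measure (EuclideanSpace ℝ (Fin N))))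
      (ν := volume)).quasiMeasurePreserving.ae h3)

/-- A function in the energy space with zero energy vanishes: it is periodic and has bounded
support. -/
lemma ae_eq_zero_of_form_self_eq_zero (hN : 0 < N) (hΩ : IsOpen Ω) (hΩb : Bornology.IsBounded Ω)
    (hδ : 0 < δ) {u : EuclideanSpace ℝ (Fin N) → ℝ} (hu0 : ∀ x, x ∉ Ω → u x = 0)
    (hu : MemEnergySpace s Ω δ u) (h0 : form s Ω δ u u = 0) : u =ᵐ[volume] 0 := by
  have : Nonempty (Fin N) := Fin.pos_iff_nonempty.1 hN
  have hfreq : ∃ᵐ h ∂(volume : Measure (EuclideanSpace ℝ (Fin N))),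
      h ∈ Metric.eball (0 : EuclideanSpace ℝ (Fin N)) δ :=
    frequently_ae_mem_iff.2
      (Metric.isOpen_eball.measure_pos volume ⟨0, Metric.mem_eball_self hδ⟩).ne'
  obtain ⟨h, ⟨hball, hper⟩, hh0⟩ := ((hfreq.and_eventually
    (ae_eq_of_form_self_eq_zero hΩ hu0 hu h0)).and_eventually (Measure.ae_ne volume 0)).exists
  have hper1 : ∀ᵐ x, u x = u (x + h) := by
    filter_upwards [hper] with x hx
    refine hx ?_
    rw [edist_comm, edist_eq_enorm_sub, add_sub_cancel_left]
    simpa using hball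
  have hpern : ∀ n : ℕ, ∀ᵐ x, u x = u (x + n • h) := by
    intro n
    induction n with
    | zero => simp
    | succ n ih =>
      filter_upwards [ih, (measurePreserving_add_right volume (n • h)).quasiMeasurePreserving.ae
        hper1] with x hx1 hx2
      rw [hx1, hx2, succ_nsmul, add_assoc]
  obtain ⟨R, hR⟩ := hΩb.exists_norm_le
  -- Translation by `n • h` is longer than `2R`, so it carries every point of Ω outside Ω.
  obtain ⟨n, hn⟩ := exists_nat_gt (2 * R / ‖h‖)
  rw [div_lt_iff₀ (norm_pos_iff.2 hh0)] at hn
  filter_upwards [hpern n] with x hx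
  by_cases hxΩ : x ∈ Ω
  · rw [hx]
    refine hu0 _ fun hmem => ?_
    have h1 := hR _ hxΩ
    have h2 := hR _ hmem
    have h3 : ‖n • h‖ ≤ ‖x + n • h‖ + ‖x‖ := by
      simpa using norm_sub_le (x + n • h) x
    rw [← Nat.cast_smul_eq_nsmul ℝ, norm_smul, Real.norm_of_nonneg (Nat.cast_nonneg n),
      Nat.cast_smul_eq_nsmul] at h3
    linarith
  · exact hu0 x hxΩ

lemma form_self_pos (hN : 0 < N) (hΩ : IsOpen Ω) (hΩb : Bornology.IsBounded Ω)
    (hδ : 0 < δ) {f : Lp ℝ 2 (volume.restrict Ω)} (hf : MemEnergySpace s Ω δ (Ω.indicator f))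
    (hf0 : f ≠ 0) : 0 < form s Ω δ (Ω.indicator f) (Ω.indicator f) := by
  refine (form_self_nonneg _).lt_of_ne' fun h0 => hf0 ?_
  have h1 := ae_eq_zero_of_form_self_eq_zero hN hΩ hΩb hδ
    (fun x hx => indicator_of_notMem hx _) hf h0
  rw [Lp.eq_zero_iff_ae_eq_zero]
  exact (indicator_ae_eq_restrict hΩ.measurableSet).symm.trans (ae_restrict_of_ae h1)

lemma not_finiteDimensional_Lp (hN : 0 < N) (hΩ : IsOpen Ω) (hΩn : Ω.Nonempty) :
    ¬ FiniteDimensional ℝ (Lp ℝ 2 (volume.restrict Ω)) := by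
  intro hfd
  have : Nonempty (Fin N) := Fin.pos_iff_nonempty.1 hN
  obtain ⟨x₀, hx₀⟩ := hΩn
  obtain ⟨r, hr, hball⟩ := Metric.isOpen_iff.1 hΩ x₀ hx₀
  -- Disjoint open annuli inside a ball of Ω; their indicators form an infinite orthogonal family.
  let A : ℕ → Set (EuclideanSpace ℝ (Fin N)) := fun k =>
    {x | r / (k + 2) < ‖x - x₀‖ ∧ ‖x - x₀‖ < r / (k + 1)}
  have hAo : ∀ k, IsOpen (A k) := fun k =>
    have hc : Continuous fun x : EuclideanSpace ℝ (Fin N) => ‖x - x₀‖ := by fun_prop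
    (isOpen_lt continuous_const hc).inter (isOpen_lt hc continuous_const)
  have hAsub : ∀ k, A k ⊆ Metric.ball x₀ r := fun k x hx => by
    rw [Metric.mem_ball, dist_eq_norm]
    exact hx.2.trans_le (div_le_self hr.le (by linarith [(Nat.cast_nonneg k : (0 : ℝ) ≤ k)]))
  have hAne : ∀ k, (A k).Nonempty := by
    intro k
    obtain ⟨t, ht1, ht2⟩ := exists_between (show r / ((k : ℝ) + 2) < r / (k + 1) by
      gcongr; norm_num)
    obtain ⟨e, he⟩ := exists_norm_eq (EuclideanSpace ℝ (Fin N))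
      (show 0 ≤ t from le_trans (by positivity) ht1.le)
    exact ⟨x₀ + e, by simp [A, he, ht1, ht2]⟩
  have hAd : ∀ k l, k ≠ l → A k ∩ A l = ∅ := by
    have hlt : ∀ k l, k < l → A k ∩ A l = ∅ := by
      intro k l hkl
      refine eq_empty_of_forall_notMem fun x hx => ?_
      have h1 : r / ((l : ℝ) + 1) ≤ r / (k + 2) := by
        have : (k : ℝ) + 1 ≤ l := by exact_mod_cast hkl
        exact div_le_div_of_nonneg_left hr.le (by positivity) (by linarith)
      linarith [hx.1.1, hx.2.2]
    intro k l hkl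
    rcases hkl.lt_or_gt with h | h
    · exact hlt k l h
    · rw [inter_comm]
      exact hlt l k h
  have hAfin : ∀ k, (volume.restrict Ω) (A k) ≠ ⊤ := fun k =>
    ((Measure.restrict_apply_le _ _).trans_lt
      ((measure_mono (hAsub k)).trans_lt measure_ball_lt_top)).ne
  let e : ℕ → Lp ℝ 2 (volume.restrict Ω) := fun k =>
    indicatorConstLp 2 (hAo k).measurableSet (hAfin k) (1 : ℝ)
  have hinner : ∀ k l, inner ℝ (e k) (e l) = (volume.restrict Ω).real (A k ∩ A l) := fun k l => by
    rw [L2.inner_indicatorConstLp_indicatorConstLp _ _ (hAfin k) (hAfin l)]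
    simp
  have hli : LinearIndependent ℝ e := by
    refine linearIndependent_of_ne_zero_of_inner_eq_zero (fun k hk => ?_) fun k l hkl => ?_
    · have h1 := hinner k k
      rw [hk, inner_zero_left, inter_self] at h1
      have h2 : (volume.restrict Ω) (A k) = 0 :=
        (measureReal_eq_zero_iff (hAfin k)).1 h1.symm
      rw [Measure.restrict_apply (hAo k).measurableSet,
        inter_eq_left.2 ((hAsub k).trans hball)] at h2
      exact ((hAo k).measure_pos volume (hAne k)).ne' h2
    · change inner ℝ (e k) (e l) = 0
      rw [hinner, hAd k l hkl, measureReal_empty]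
  exact Set.infinite_univ (α := ℕ) (Set.finite_univ_iff.2 hli.finite)

lemma inner_energySpace_of_mem_eigenspace (hs : s ∈ Ioo (0 : ℝ) 1) (hΩ : IsOpen Ω) {μ : ℝ}
    {w : EnergySpace s Ω δ hΩ} (hw : energyEmbedding s Ω δ hΩ w ∈ eigenspace s Ω δ μ)
    (v : EnergySpace s Ω δ hΩ) :
    inner ℝ w v = (1 + μ / (normConst N s / 2)) *
      inner ℝ (energyEmbedding s Ω δ hΩ w) (energyEmbedding s Ω δ hΩ v) := by
  have hc := normConst_pos (N := N) hs
  have h1 := ((mem_eigenspace_iff hΩ).1 hw).2 _ (memEnergySpace_energyEmbedding hΩ v)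
  rw [inner_energySpace, one_add_mul, div_mul_eq_mul_div, ← h1,
    mul_div_cancel_left₀ _ (by positivity)]

lemma mem_eigenspace_of_inner_energySpace (hΩ : IsOpen Ω) {r : ℝ}
    {w : EnergySpace s Ω δ hΩ} (hw : ∀ v, inner ℝ w v =
      r * inner ℝ (energyEmbedding s Ω δ hΩ w) (energyEmbedding s Ω δ hΩ v)) :
    energyEmbedding s Ω δ hΩ w ∈ eigenspace s Ω δ (normConst N s / 2 * (r - 1)) := by
  refine (mem_eigenspace_iff hΩ).2 ⟨memEnergySpace_energyEmbedding hΩ w, fun g hg => ?_⟩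
  obtain ⟨v, rfl⟩ := exists_energyEmbedding_eq hΩ hg
  have h1 := inner_energySpace hΩ w v
  rw [hw v] at h1
  rw [← sub_eq_iff_eq_add'.2 h1]
  ring

lemma isOrtho_eigenspace (hΩ : IsOpen Ω) {μ ν : ℝ} (hμν : μ ≠ ν) :
    eigenspace s Ω δ μ ⟂ eigenspace s Ω δ ν := by
  rw [Submodule.isOrtho_iff_inner_eq]
  intro f hf g hg
  have hf := (mem_eigenspace_iff hΩ).1 hf
  have hg := (mem_eigenspace_iff hΩ).1 hg
  have h1 := hf.2 g hg.1
  have h2 := hg.2 f hf.1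
  rw [form_comm, h1, real_inner_comm f g, ← sub_eq_zero, ← sub_mul, mul_eq_zero] at h2
  exact h2.resolve_left (sub_ne_zero.2 hμν)

/-- On eigenfunctions with eigenvalue at most `t` the energy is controlled by the L² norm. This is
the bounded right inverse that `FiniteRankApproximable.finiteDimensional` requires. -/
lemma exists_norm_le_of_mem_iSup_eigenspace (hs : s ∈ Ioo (0 : ℝ) 1) (hΩ : IsOpen Ω) (t : ℝ)
    {f : Lp ℝ 2 (volume.restrict Ω)} (hf : f ∈ ⨆ μ ∈ Iic t, eigenspace s Ω δ μ) :
    ∃ w, energyEmbedding s Ω δ hΩ w = f ∧ ‖w‖ ≤ (1 + |t| / (normConst N s / 2)) * ‖f‖ := by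
  have hc : 0 < normConst N s / 2 := half_pos (normConst_pos hs)
  obtain ⟨a, ha, rfl⟩ := (Submodule.mem_iSup_iff_exists_finsupp _ _).1 hf
  have ha' : ∀ μ, a μ ∈ eigenspace s Ω δ μ ∧ (t < μ → a μ = 0) := by
    intro μ
    have h1 := ha μ
    by_cases hμ : μ ∈ Iic t
    · rw [iSup_pos hμ] at h1
      exact ⟨h1, fun h => absurd hμ (not_le.2 h)⟩
    · rw [iSup_neg hμ, Submodule.mem_bot] at h1
      exact ⟨h1 ▸ Submodule.zero_mem _, fun _ => h1⟩
  have hex : ∀ μ, ∃ w, energyEmbedding s Ω δ hΩ w = a μ := fun μ =>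
    exists_energyEmbedding_eq hΩ ((mem_eigenspace_iff hΩ).1 (ha' μ).1).1
  choose w hw using hex
  rw [Finsupp.sum]
  have hwf : energyEmbedding s Ω δ hΩ (∑ μ ∈ a.support, w μ) = ∑ μ ∈ a.support, a μ := by
    rw [map_sum]
    exact Finset.sum_congr rfl fun μ _ => hw μ
  refine ⟨∑ μ ∈ a.support, w μ, hwf, ?_⟩
  set f := ∑ μ ∈ a.support, a μ with hf
  -- By orthogonality this inner product equals `‖a μ‖²`; the sign permits replacing each `μ` by
  -- `|t|` termwise.
  have h1 : ∀ μ ∈ a.support, 0 ≤ inner ℝ (a μ) f := by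
    intro μ hμ
    rw [hf, inner_sum, Finset.sum_eq_single_of_mem μ hμ fun ν _ hν =>
      (isOrtho_eigenspace hΩ (Ne.symm hν)).inner_eq (ha' μ).1 (ha' ν).1]
    exact real_inner_self_nonneg
  have h2 : ‖∑ μ ∈ a.support, w μ‖ ^ 2 ≤ (1 + |t| / (normConst N s / 2)) * ‖f‖ ^ 2 := by
    rw [← real_inner_self_eq_norm_sq, ← real_inner_self_eq_norm_sq, sum_inner]
    have h3 : inner ℝ f f = ∑ μ ∈ a.support, inner ℝ (a μ) f := by rw [← sum_inner]
    rw [h3, Finset.mul_sum]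
    refine Finset.sum_le_sum fun μ hμ => ?_
    rw [inner_energySpace_of_mem_eigenspace hs hΩ (μ := μ) (by rw [hw]; exact (ha' μ).1), hwf, hw]
    refine mul_le_mul_of_nonneg_right ?_ (h1 μ hμ)
    have hμt : μ ≤ |t| := by
      by_contra! hlt
      exact (Finsupp.mem_support_iff.1 hμ) ((ha' μ).2 ((le_abs_self t).trans_lt hlt))
    gcongr
  have hC : 1 ≤ 1 + |t| / (normConst N s / 2) := le_add_of_nonneg_right (by positivity)
  refine (pow_le_pow_iff_left₀ (norm_nonneg _) (by positivity) two_ne_zero).1 (h2.trans ?_)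
  rw [mul_pow]
  exact mul_le_mul_of_nonneg_right (le_self_pow₀ hC two_ne_zero) (sq_nonneg _)

lemma discreteSpectrum_eigenspace (hN : 0 < N) (hs : s ∈ Ioo (0 : ℝ) 1) (hΩ : IsOpen Ω)
    (hΩb : Bornology.IsBounded Ω) (hδ : 0 < δ) : DiscreteSpectrum (eigenspace s Ω δ) where
  ortho _ _ := isOrtho_eigenspace hΩ
  pos μ hμ := by
    obtain ⟨f, hf, hf0⟩ := (Submodule.ne_bot_iff _).1 hμ
    have hf := (mem_eigenspace_iff hΩ).1 hf
    have h1 := hf.2 f hf.1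
    have h2 := form_self_pos hN hΩ hΩb hδ hf.1 hf0
    have h3 : 0 < μ * inner ℝ f f := h1 ▸ mul_pos (half_pos (normConst_pos hs)) h2
    exact pos_of_mul_pos_left h3 real_inner_self_nonneg
  fin t := (finiteRankApproximable_energyEmbedding hs.1 hΩ hΩb hδ).finiteDimensional _ _
    fun _ hf => exists_norm_le_of_mem_iSup_eigenspace hs hΩ t hf
  dense := topologicalClosure_eq_top_of_eigenvectors
    (finiteRankApproximable_energyEmbedding hs.1 hΩ hΩb hδ).isCompactOperator
    (eq_zero_of_forall_inner_energyEmbedding hN hs hΩ hΩb) _ fun _ _ hw =>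
      Submodule.mem_iSup_of_mem _ (mem_eigenspace_of_inner_energySpace hΩ hw)

end Spectrum

/-! ### Horizons beyond the diameter: a shift by a constant. -/

section Shift

variable {N : ℕ} {s : ℝ} {Ω : Set (EuclideanSpace ℝ (Fin N))}

lemma interaction_top (hΩn : Ω.Nonempty) : interaction Ω ⊤ = univ := by
  simp [interaction, domain_top hΩn, edist_lt_top]

/-- At distance at least `r` one of the two points is outside Ω, so the cross terms of the product
vanish. At smaller distances the tail is zero, and non-interacting pairs lie entirely outside Ω. -/
lemma integrand_eq_add_tailKernel {r : ℝ} (hr : ∀ x ∈ Ω, ∀ y ∈ Ω, ‖x - y‖ < r)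
    {u v : EuclideanSpace ℝ (Fin N) → ℝ} (hu : ∀ x, x ∉ Ω → u x = 0) (hv : ∀ x, x ∉ Ω → v x = 0)
    (p : EuclideanSpace ℝ (Fin N) × EuclideanSpace ℝ (Fin N)) :
    integrand s u v p = (interaction Ω (ENNReal.ofReal r)).indicator (integrand s u v) p +
      (u p.1 * v p.1 + u p.2 * v p.2) * tailKernel N s r (p.1 - p.2) := by
  obtain ⟨x, y⟩ := p
  have hlt : edist x y < ENNReal.ofReal r ↔ ‖x - y‖ < r := by
    rw [edist_dist, dist_eq_norm]
    exact ENNReal.ofReal_lt_ofReal_iff_of_nonneg (norm_nonneg _)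
  by_cases hxy : ‖x - y‖ < r
  · have ht : tailKernel N s r (x - y) = 0 := by
      simp [tailKernel, hxy]
    rw [ht, mul_zero, add_zero]
    by_cases hmem : (x, y) ∈ interaction Ω (ENNReal.ofReal r)
    · rw [indicator_of_mem hmem]
    · rw [indicator_of_notMem hmem]
      have h1 : ¬ (x ∈ Ω ∨ y ∈ Ω) := fun h => hmem (mem_interaction_of_mem h (hlt.2 hxy))
      push Not at h1
      simp [integrand, hu x h1.1, hu y h1.2]
  · have ht : tailKernel N s r (x - y) = (‖x - y‖ ^ ((N : ℝ) + 2 * s))⁻¹ := by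
      simp [tailKernel, not_lt.1 hxy]
    rw [ht, indicator_of_notMem fun h => hxy (hlt.1 h.2.2), zero_add, integrand, div_eq_mul_inv]
    congr 1
    have h1 : x ∉ Ω ∨ y ∉ Ω := by
      by_contra! h
      exact hxy (hr x h.1 y h.2)
    rcases h1 with h | h
    · simp [hu x h, hv x h]
    · simp [hu y h, hv y h]

lemma indicator_mul_indicator (f g : EuclideanSpace ℝ (Fin N) → ℝ) :
    (fun x => Ω.indicator f x * Ω.indicator g x) = Ω.indicator fun x => f x * g x := by
  funext x
  by_cases hx : x ∈ Ω <;> simp [hx]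

lemma integral_indicator_mul (hΩ : IsOpen Ω) (f g : Lp ℝ 2 (volume.restrict Ω)) :
    Integrable (fun x => Ω.indicator f x * Ω.indicator g x) ∧
      ∫ x, Ω.indicator f x * Ω.indicator g x = inner ℝ f g := by
  rw [indicator_mul_indicator, integral_indicator hΩ.measurableSet, inner_eq_setIntegral,
    integrable_indicator_iff hΩ.measurableSet]
  exact ⟨(Lp.memLp f).integrable_mul (Lp.memLp g), rfl⟩

lemma integrable_add_mul_tailKernel (hs : 0 < s) (hΩ : IsOpen Ω) {r : ℝ} (hr : 0 < r)
    (f g : Lp ℝ 2 (volume.restrict Ω)) :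
    Integrable (fun p : EuclideanSpace ℝ (Fin N) × EuclideanSpace ℝ (Fin N) =>
      (Ω.indicator f p.1 * Ω.indicator g p.1 + Ω.indicator f p.2 * Ω.indicator g p.2) *
        tailKernel N s r (p.1 - p.2)) (volume.prod volume) ∧
    ∫ p, (Ω.indicator f p.1 * Ω.indicator g p.1 + Ω.indicator f p.2 * Ω.indicator g p.2) *
        tailKernel N s r (p.1 - p.2)
      ∂((volume : Measure (EuclideanSpace ℝ (Fin N))).prod volume) =
        2 * (inner ℝ f g * ∫ h, tailKernel N s r h) := by
  have h1 := integral_indicator_mul hΩ f g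
  rw [← h1.2]
  exact integrable_add_mul_kernel h1.1 (integrable_tailKernel hs hr) (tailKernel_neg r)

lemma memEnergySpace_top_iff (hs : 0 < s) (hΩ : IsOpen Ω) (hΩn : Ω.Nonempty) {r : ℝ} (hr0 : 0 < r)
    (hr : ∀ x ∈ Ω, ∀ y ∈ Ω, ‖x - y‖ < r) (f : Lp ℝ 2 (volume.restrict Ω)) :
    MemEnergySpace s Ω ⊤ (Ω.indicator f) ↔
      MemEnergySpace s Ω (ENNReal.ofReal r) (Ω.indicator f) := by
  have h0 : ∀ x, x ∉ Ω → Ω.indicator f x = 0 := fun x hx => indicator_of_notMem hx _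
  rw [memEnergySpace_indicator_iff hΩ (Lp.memLp f), memEnergySpace_indicator_iff hΩ (Lp.memLp f),
    interaction_top hΩn, integrableOn_univ,
    ← integrable_indicator_iff (measurableSet_interaction hΩ)]
  have ht := (integrable_add_mul_tailKernel hs hΩ hr0 f f).1
  refine ⟨fun h => (h.sub ht).congr (Eventually.of_forall fun p => ?_),
    fun h => (h.add ht).congr (Eventually.of_forall fun p => ?_)⟩
  · rw [Pi.sub_apply, integrand_eq_add_tailKernel hr h0 h0, add_sub_cancel_right]
  · rw [Pi.add_apply, ← integrand_eq_add_tailKernel hr h0 h0]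

lemma form_top_eq (hs : 0 < s) (hΩ : IsOpen Ω) (hΩn : Ω.Nonempty) {r : ℝ} (hr0 : 0 < r)
    (hr : ∀ x ∈ Ω, ∀ y ∈ Ω, ‖x - y‖ < r) {f g : Lp ℝ 2 (volume.restrict Ω)}
    (hf : MemEnergySpace s Ω (ENNReal.ofReal r) (Ω.indicator f))
    (hg : MemEnergySpace s Ω (ENNReal.ofReal r) (Ω.indicator g)) :
    form s Ω ⊤ (Ω.indicator f) (Ω.indicator g) =
      form s Ω (ENNReal.ofReal r) (Ω.indicator f) (Ω.indicator g) +
        2 * (inner ℝ f g * ∫ h, tailKernel N s r h) := by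
  have ht := integrable_add_mul_tailKernel hs hΩ hr0 f g
  have hi := (integrable_indicator_iff (measurableSet_interaction hΩ)).2 (hf.integrable hg)
  rw [form, form, interaction_top hΩn, setIntegral_univ,
    ← integral_indicator (measurableSet_interaction hΩ), ← ht.2, ← integral_add hi ht.1]
  exact integral_congr_ae (Eventually.of_forall fun p => integrand_eq_add_tailKernel hr
    (fun x hx => indicator_of_notMem hx _) (fun x hx => indicator_of_notMem hx _) p)

/-- If the horizon exceeds the diameter of `Ω`, then the operators with finite and with infinite
horizon differ by a multiple of the identity. -/
lemma eigenspace_ofReal_eq (hs : 0 < s) (hΩ : IsOpen Ω) (hΩn : Ω.Nonempty) {r : ℝ} (hr0 : 0 < r)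
    (hr : ∀ x ∈ Ω, ∀ y ∈ Ω, ‖x - y‖ < r) :
    eigenspace s Ω (ENNReal.ofReal r) = fun μ =>
      eigenspace s Ω ⊤ (μ + normConst N s * ∫ h, tailKernel N s r h) := by
  funext μ
  ext f
  rw [mem_eigenspace_iff hΩ, mem_eigenspace_iff hΩ, memEnergySpace_top_iff hs hΩ hΩn hr0 hr]
  refine and_congr_right fun hf => forall_congr' fun g => ?_
  rw [memEnergySpace_top_iff hs hΩ hΩn hr0 hr]
  refine forall_congr' fun hg => ?_
  rw [form_top_eq hs hΩ hΩn hr0 hr hf hg, mul_add, add_mul,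
    show normConst N s / 2 * (2 * (inner ℝ f g * ∫ h, tailKernel N s r h)) =
      normConst N s * (∫ h, tailKernel N s r h) * inner ℝ f g by ring, add_left_inj]

lemma exists_forall_norm_sub_lt (hΩb : Bornology.IsBounded Ω) :
    ∃ R : ℝ, 0 < R ∧ ∀ r, R ≤ r → ∀ x ∈ Ω, ∀ y ∈ Ω, ‖x - y‖ < r := by
  obtain ⟨C, hC⟩ := hΩb.exists_norm_le
  refine ⟨2 * |C| + 1, by positivity, fun r hr x hx y hy => ?_⟩
  have h1 := norm_sub_le x y
  linarith [hC x hx, hC y hy, le_abs_self C]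

lemma eigenvalue_eq_level (δ : ENNReal) (k : ℕ) :
    eigenvalue s Ω δ k = level (eigenspace s Ω δ) k := rfl

lemma eigenvalue_ofReal_eq (hN : 0 < N) (hs : s ∈ Ioo (0 : ℝ) 1) (hΩ : IsOpen Ω)
    (hΩb : Bornology.IsBounded Ω) (hΩn : Ω.Nonempty) {r : ℝ} (hr0 : 0 < r)
    (hr : ∀ x ∈ Ω, ∀ y ∈ Ω, ‖x - y‖ < r) (k : ℕ) :
    eigenvalue s Ω (ENNReal.ofReal r) k =
      eigenvalue s Ω ⊤ k - normConst N s * ∫ h, tailKernel N s r h := by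
  have h1 := discreteSpectrum_eigenspace hN hs hΩ hΩb (ENNReal.ofReal_pos.2 hr0)
  rw [eigenvalue_eq_level, eigenvalue_eq_level]
  rw [eigenspace_ofReal_eq hs.1 hΩ hΩn hr0 hr] at h1 ⊢
  exact level_comp_add _ _ (discreteSpectrum_eigenspace hN hs hΩ hΩb ENNReal.zero_lt_top) h1
    (not_finiteDimensional_Lp hN hΩ hΩn) k

lemma eigenspace_eigenvalue_ofReal_eq (hN : 0 < N) (hs : s ∈ Ioo (0 : ℝ) 1) (hΩ : IsOpen Ω)
    (hΩb : Bornology.IsBounded Ω) (hΩn : Ω.Nonempty) {r : ℝ} (hr0 : 0 < r)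
    (hr : ∀ x ∈ Ω, ∀ y ∈ Ω, ‖x - y‖ < r) (k : ℕ) :
    eigenspace s Ω (ENNReal.ofReal r) (eigenvalue s Ω (ENNReal.ofReal r) k) =
      eigenspace s Ω ⊤ (eigenvalue s Ω ⊤ k) := by
  rw [eigenvalue_ofReal_eq hN hs hΩ hΩb hΩn hr0 hr, eigenspace_ofReal_eq hs.1 hΩ hΩn hr0 hr]
  simp only [sub_add_cancel]

end Shift

end FiniteHorizon

/-! ### The limit of infinite horizon. -/

theorem theorem2p11 {N : ℕ} (hN : 0 < N) {s : ℝ} (hs : s ∈ Ioo (0 : ℝ) 1)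
    {Ω : Set (EuclideanSpace ℝ (Fin N))} (hΩo : IsOpen Ω) (hΩb : Bornology.IsBounded Ω)
    (hΩn : Ω.Nonempty) :
    -- the eigenvalues and the eigenfunctions exist, for every finite or infinite horizon
    (∀ δ : ENNReal, 0 < δ →
      (∃ φ, FiniteHorizon.IsEigenbasis s Ω δ φ) ∧
        0 < FiniteHorizon.eigenvalue s Ω δ 0 ∧
        Tendsto (FiniteHorizon.eigenvalue s Ω δ) atTop atTop ∧
        ∀ k, 1 ≤ FiniteHorizon.multiplicity s Ω δ k) ∧
    -- convergence of the eigenvalues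
    (∀ k, Tendsto (fun δ : ℝ => FiniteHorizon.eigenvalue s Ω (ENNReal.ofReal δ) k) atTop
      (𝓝 (FiniteHorizon.eigenvalue s Ω ⊤ k))) ∧
    -- convergence of the eigenfunctions along a subsequence
    (∀ φ : ℝ → ℕ → Lp ℝ 2 (volume.restrict Ω),
      (∀ δ : ℝ, 0 < δ → FiniteHorizon.IsEigenbasis s Ω (ENNReal.ofReal δ) (φ δ)) →
      ∀ d : ℕ → ℝ, Tendsto d atTop atTop →
        ∃ σ : ℕ → ℕ, StrictMono σ ∧ ∃ ψ, FiniteHorizon.IsEigenbasis s Ω ⊤ ψ ∧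
          ∀ k, Tendsto (fun n => φ (d (σ n)) k) atTop (𝓝 (ψ k))) ∧
    -- convergence of the multiplicities
    (∀ k, Tendsto (fun δ : ℝ => FiniteHorizon.multiplicity s Ω (ENNReal.ofReal δ) k) atTop
      (𝓝 (FiniteHorizon.multiplicity s Ω ⊤ k))) := by
  have hfd := FiniteHorizon.not_finiteDimensional_Lp hN hΩo hΩn
  have hds := fun {δ : ENNReal} (hδ : 0 < δ) =>
    FiniteHorizon.discreteSpectrum_eigenspace hN hs hΩo hΩb hδ
  obtain ⟨R, hR0, hR⟩ := FiniteHorizon.exists_forall_norm_sub_lt hΩb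
  have hspace := fun {r : ℝ} (hr : R ≤ r) (k : ℕ) =>
    FiniteHorizon.eigenspace_eigenvalue_ofReal_eq hN hs hΩo hΩb hΩn (hR0.trans_le hr) (hR r hr) k
  refine ⟨fun δ hδ => ⟨?_, (hds hδ).level_pos hfd 0, (hds hδ).tendsto_level hfd,
    (hds hδ).finrank_level_pos hfd⟩, fun k => ?_, fun φ hφ d hd => ?_, fun k => ?_⟩
  · obtain ⟨ψ, ho, hψ⟩ := (hds hδ).exists_orthonormal hfd
    exact ⟨ψ, ho, (hds hδ).complete_of_orthonormal hfd ho hψ, hψ⟩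
  · have h1 := ((FiniteHorizon.tendsto_integral_tailKernel (N := N) hs.1).const_mul
      (FiniteHorizon.normConst N s)).const_sub (FiniteHorizon.eigenvalue s Ω ⊤ k)
    rw [mul_zero, sub_zero] at h1
    refine h1.congr' ?_
    filter_upwards [eventually_ge_atTop R] with r hr
    exact (FiniteHorizon.eigenvalue_ofReal_eq hN hs hΩo hΩb hΩn (hR0.trans_le hr) (hR r hr) k).symm
  -- Dropping the first `n₀` terms leaves only horizons for which the eigenspaces already coincide
  -- with those of infinite horizon.
  · obtain ⟨n₀, hn₀⟩ := eventually_atTop.1 (hd.eventually_ge_atTop R)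
    have hge : ∀ n, R ≤ d (n + n₀) := fun n => hn₀ _ (Nat.le_add_left _ _)
    have hb := fun n => hφ (d (n + n₀)) (hR0.trans_le (hge n))
    obtain ⟨σ, hσ, ψ, ho, hψ, hlim⟩ := (hds ENNReal.zero_lt_top).exists_subseq
      (φ := fun n => φ (d (n + n₀))) (fun n => (hb n).orthonormal) fun n k => by
        have h1 := (hb n).mem_eigenspace k
        rwa [hspace (hge n)] at h1
    exact ⟨fun n => σ n + n₀, fun a b hab => Nat.add_lt_add_right (hσ hab) n₀, ψ,
      ⟨ho, (hds ENNReal.zero_lt_top).complete_of_orthonormal hfd ho hψ, hψ⟩, hlim⟩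
  · refine tendsto_const_nhds.congr' ?_
    filter_upwards [eventually_ge_atTop R] with r hr
    rw [FiniteHorizon.multiplicity, FiniteHorizon.multiplicity, hspace hr]
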